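/- Let $p,q\ge 1$, $d=p+q$, and let $Z_i=(X_i,Y_i)$, $i\ge 1$, be i.i.d. with law $P$ on $\mathbb R^p\times\mathbb R^q$. Let $Q^*$ be the product of the marginals of $P$, $I(X;Y)=D(P\|Q^*)$, and $i_n=\frac1n\log\prod_{i\le n}\frac{dP}{dQ^*}(Z_i)$. Let $\hat P_n$ be the empirical distribution of $Z_1,\dots,Z_n$ and $\hat Q_n^*(A^1\times A^2)=\hat P_n(A^1\times\mathbb R^q)\,\hat P_n(\mathbb R^p\times A^2)$. For a finite partition $\pi$ of $\mathbb R^d$ into product cells, put $D_{\sigma(\pi)}(P\|Q^*)=\sum_{A\in\pi}P(A)\ln\frac{P(A)}{Q^*(A)}$, define $D_{\sigma(\pi)}(\hat P_n\|\hat Q^*_n)$ likewise, and let $\hat i_\pi=\frac1n\ln\prod_{i\le n}\frac{\hat P_n(A(Z_i))}{\hat Q_n^*(A(Z_i))}$, where $A(z)$ is the cell of $\pi$ containing $z$. Let $T^{full}_{b}$ be the binary tree grown from the root cell $\mathbb R^d$ by splitting each cell along one coordinate, selected by an arbitrary (possibly data-dependent) rule, at the median of the sample points in the cell (the entry of rank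 $\lceil m/2\rceil$ in the ordered list of the $m$ projected points; points at the median go left), as long as both new cells contain sample points and have empirical probability at least $b$. Write $T\ll T^{full}_b$ if $T$ is a subtree with the same root in which each node has zero or two children, $|T|$ for its number of leaves, and $\pi_T$ for the partition formed by its leaf cells. Let $r_{b,\delta}(1)=0$ and, for $k\ge2$, $$r_{b,\delta}(k)=\frac{24\sqrt2}{b\sqrt n}\sqrt{\ln\frac{8}{\delta b}+k\big[(d+1)\ln 2+d\ln n\big]}.$$ Let $\hat T_{b,\delta}$ be any maximizer of $D_{\sigma(\pi_T)}(\hat P_n\|\hat Q^*_n)-r_{b,\delta}(|T|)$ over $T\ll T^{full}_b$, and let $\hat i_n$ denote $\hat i_\pi$ for its partition $\pi=\pi_{\hat T_{b_n,\delta_n}}$. **Theorem 2.** Let $b_n>0$ and $\delta_n>0$ for all $n\ge 1$, with $b_n\approx n^{-l}$ (that is, $b_n=\Theta(n^{-l})$) for some $l\in(0,1/3)$, $\delta_n=o(1)$ and $1/\delta_n=O(e^{n^{1/3}})$. (i) If $X$ and $Y$ are independent ($\mathcal H_0$), then for every $n\ge1$, with probability at least $1-\delta_n$, every maximizer $\hat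 T_{b_n,\delta_n}$ gives the one-cell partition $\{\mathbb R^d\}$ and $\hat i_n=i_n=0$. (ii) If $X$ and $Y$ are not independent ($\mathcal H_1$) and $I(X;Y)<\infty$, then for every $n\ge1$, with probability at least $1-\delta_n$, for every maximizer, $$i_n-\hat i_n\le i_n-I(X;Y)+\min_{T\ll T^{full}_{b_n}}\Big[D(P\|Q^*)-D_{\sigma(\pi_T)}(P\|Q^*)+2r_{b_n,\delta_n}(|T|)\Big].$$ Consequently, in each case, for every $\epsilon>0$ there is $N(\epsilon)$ such that for all $n\ge N(\epsilon)$ the stated event has probability at least $1-\epsilon$. -/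

import Mathlib

open MeasureTheory ProbabilityTheory Filter Asymptotics

namespace TSP

/-- The observation space `ℝ^p × ℝ^q = ℝ^d`, `d = p + q`. -/
abbrev Obs (p q : ℕ) : Type := (Fin p → ℝ) × (Fin q → ℝ)

/-- A cell with product structure `A = A¹ × A²`. -/
structure Cell (p q : ℕ) where
  fst : Set (Fin p → ℝ)
  snd : Set (Fin q → ℝ)

namespace Cell

variable {p q : ℕ}

/-- The subset `A¹ × A²` of the observation space. -/
def toSet (A : Cell p q) : Set (Obs p q) := A.fst ×ˢ A.snd

/-- The root cell `ℝ^d`. -/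
def root (p q : ℕ) : Cell p q := ⟨Set.univ, Set.univ⟩

/-- The part of a cell where the coordinate `j` is at most `t`. -/
def lower (A : Cell p q) (j : Fin p ⊕ Fin q) (t : ℝ) : Cell p q :=
  match j with
  | Sum.inl i => ⟨A.fst ∩ {x | x i ≤ t}, A.snd⟩
  | Sum.inr i => ⟨A.fst, A.snd ∩ {y | y i ≤ t}⟩

/-- The part of a cell where the coordinate `j` is larger than `t`. -/
def upper (A : Cell p q) (j : Fin p ⊕ Fin q) (t : ℝ) : Cell p q :=
  match j with
  | Sum.inl i => ⟨A.fst ∩ {x | t < x i}, A.snd⟩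
  | Sum.inr i => ⟨A.fst, A.snd ∩ {y | t < y i}⟩

end Cell

section Empirical

variable {p q n : ℕ}

/-- The `j`-th of the `d = p + q` coordinates of a point. -/
def coordVal (j : Fin p ⊕ Fin q) (w : Obs p q) : ℝ := Sum.elim w.1 w.2 j

open Classical in
/-- The indices of the sample points that lie in `S`. -/
noncomputable def pointsIn (z : Fin n → Obs p q) (S : Set (Obs p q)) : Finset (Fin n) :=
  Finset.univ.filter fun i => z i ∈ S

/-- The empirical probability `P̂ₙ(S)`. -/
noncomputable def empProb (z : Fin n → Obs p q) (S : Set (Obs p q)) : ℝ :=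
  ((pointsIn z S).card : ℝ) / n

/-- `P̂ₙ(A)` for a cell `A`. -/
noncomputable def empP (z : Fin n → Obs p q) (A : Cell p q) : ℝ := empProb z A.toSet

/-- `Q̂*ₙ(A¹ × A²) = P̂ₙ(A¹ × ℝ^q) · P̂ₙ(ℝ^p × A²)`. -/
noncomputable def empQ (z : Fin n → Obs p q) (A : Cell p q) : ℝ :=
  empProb z (A.fst ×ˢ Set.univ) * empProb z (Set.univ ×ˢ A.snd)

/-- The median of the `j`-th coordinates of the `m` sample points in the cell `A`: the entry of
rank `⌈m / 2⌉` of the ordered sequence. -/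
noncomputable def cellMedian (z : Fin n → Obs p q) (A : Cell p q) (j : Fin p ⊕ Fin q) : ℝ :=
  (((pointsIn z A.toSet).val.map fun i => coordVal j (z i)).sort (· ≤ ·)).getD
    (((pointsIn z A.toSet).card - 1) / 2) 0

/-- The left child obtained by splitting `A` at the median of coordinate `j`. -/
noncomputable def leftCell (z : Fin n → Obs p q) (j : Fin p ⊕ Fin q) (A : Cell p q) : Cell p q :=
  A.lower j (cellMedian z A j)

/-- The right child obtained by splitting `A` at the median of coordinate `j`. -/
noncomputable def rightCell (z : Fin n → Obs p q) (j : Fin p ⊕ Fin q) (A : Cell p q) : Cell p q :=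
  A.upper j (cellMedian z A j)

/-- The growing phase splits `A` along coordinate `j` iff both created cells contain sample points
and have empirical probability at least `b`. (For `b > 0` the former follows from the latter.) -/
def Splittable (z : Fin n → Obs p q) (b : ℝ) (j : Fin p ⊕ Fin q) (A : Cell p q) : Prop :=
  ((pointsIn z (leftCell z j A).toSet).Nonempty ∧ b ≤ empP z (leftCell z j A)) ∧
  ((pointsIn z (rightCell z j A).toSet).Nonempty ∧ b ≤ empP z (rightCell z j A))

theorem card_lower_add_upper (z : Fin n → Obs p q) (A : Cell p q) (j : Fin p ⊕ Fin q) (t : ℝ) :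
    (pointsIn z (A.lower j t).toSet).card + (pointsIn z (A.upper j t).toSet).card
      = (pointsIn z A.toSet).card := by
  classical
  have h1 : pointsIn z (A.lower j t).toSet
      = (pointsIn z A.toSet).filter fun i => coordVal j (z i) ≤ t := by
    ext i
    cases j <;>
      simp only [pointsIn, Cell.lower, Cell.toSet, coordVal, Finset.mem_filter, Finset.mem_univ,
        Set.mem_prod, Set.mem_inter_iff, Set.mem_ofPred_eq, Sum.elim_inl, Sum.elim_inr] <;> tauto
  have h2 : pointsIn z (A.upper j t).toSet
      = (pointsIn z A.toSet).filter fun i => ¬ coordVal j (z i) ≤ t := by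
    ext i
    cases j <;>
      simp only [pointsIn, Cell.upper, Cell.toSet, coordVal, Finset.mem_filter, Finset.mem_univ,
        Set.mem_prod, Set.mem_inter_iff, Set.mem_ofPred_eq, Sum.elim_inl, Sum.elim_inr,
        not_le] <;> tauto
  rw [h1, h2, Finset.card_filter_add_card_filter_not]

theorem card_leftCell_lt {z : Fin n → Obs p q} {b : ℝ} {j : Fin p ⊕ Fin q} {A : Cell p q}
    (h : Splittable z b j A) :
    (pointsIn z (leftCell z j A).toSet).card < (pointsIn z A.toSet).card := by
  have h1 := card_lower_add_upper z A j (cellMedian z A j)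
  have h2 := Finset.card_pos.mpr h.2.1
  simp only [leftCell, rightCell] at *
  omega

theorem card_rightCell_lt {z : Fin n → Obs p q} {b : ℝ} {j : Fin p ⊕ Fin q} {A : Cell p q}
    (h : Splittable z b j A) :
    (pointsIn z (rightCell z j A).toSet).card < (pointsIn z A.toSet).card := by
  have h1 := card_lower_add_upper z A j (cellMedian z A j)
  have h2 := Finset.card_pos.mpr h.1.1
  simp only [leftCell, rightCell] at *
  omega

end Empirical

/-- Rooted binary trees in which every node has no child or two children. -/
inductive BinTree : Type
  | leaf : BinTree
  | node (l r : BinTree) : BinTree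

namespace BinTree

/-- The size `|T|`: the number of leaves, which is the number of cells of the partition `π_T`. -/
def size : BinTree → ℕ
  | leaf => 1
  | node l r => l.size + r.size

/-- `T.Prunes F` (written `T ≪ F` in the literature): `T` is a subtree of `F` with the same root. -/
def Prunes : BinTree → BinTree → Prop
  | leaf, _ => True
  | node _ _, leaf => False
  | node a b, node c d => a.Prunes c ∧ b.Prunes d

open Classical in
/-- The finite set of all pruned versions of a tree. -/
noncomputable def prunings : BinTree → Finset BinTree
  | leaf => {leaf}
  | node l r => insert leaf ((l.prunings ×ˢ r.prunings).image fun t => node t.1 t.2)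

theorem mem_prunings (T F : BinTree) : T ∈ F.prunings ↔ T.Prunes F := by
  induction F generalizing T with
  | leaf => cases T <;> simp [prunings, Prunes]
  | node l r ihl ihr => cases T <;> simp [prunings, Prunes, ihl, ihr]

theorem prunings_nonempty (F : BinTree) : F.prunings.Nonempty :=
  ⟨leaf, (mem_prunings _ _).mpr trivial⟩

end BinTree

section Trees

variable {p q n : ℕ}

/-- A rule that selects the splitting coordinate of each node from the data. A node is given by its
address: the list of the left (`false`) and right (`true`) moves that lead to it from the root. -/
abbrev CoordRule (p q n : ℕ) : Type := (Fin n → Obs p q) → List Bool → Fin p ⊕ Fin q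

open Classical in
/-- The full tree grown from the cell `A` at the node `v`: cells are split at medians as long as
both created cells have empirical probability at least `b`. -/
noncomputable def growTree (c : CoordRule p q n) (z : Fin n → Obs p q) (b : ℝ)
    (v : List Bool) (A : Cell p q) : BinTree :=
  if _h : Splittable z b (c z v) A then
    BinTree.node (growTree c z b (v ++ [false]) (leftCell z (c z v) A))
      (growTree c z b (v ++ [true]) (rightCell z (c z v) A))
  else BinTree.leaf
termination_by (pointsIn z A.toSet).card
decreasing_by
  · exact card_leftCell_lt _h
  · exact card_rightCell_lt _h

/-- The full tree `T^full_b` of the data `z`. -/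
noncomputable def fullTree (c : CoordRule p q n) (z : Fin n → Obs p q) (b : ℝ) : BinTree :=
  growTree c z b [] (Cell.root p q)

/-- The cells of the leaves of the tree `T`, when its root is the node `v` with cell `A`. -/
noncomputable def leafCells (c : CoordRule p q n) (z : Fin n → Obs p q) :
    BinTree → List Bool → Cell p q → List (Cell p q)
  | BinTree.leaf, _, A => [A]
  | BinTree.node l r, v, A =>
      leafCells c z l (v ++ [false]) (leftCell z (c z v) A) ++
        leafCells c z r (v ++ [true]) (rightCell z (c z v) A)

/-- The tree-indexed data-driven partition `π_T = {A_v : v a leaf of T}`, listed from left to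
right. -/
noncomputable def treePartition (c : CoordRule p q n) (z : Fin n → Obs p q) (T : BinTree) :
    List (Cell p q) :=
  leafCells c z T [] (Cell.root p q)

end Trees

section Information

variable {p q n : ℕ}

/-- `∑_{A ∈ π} f(A) log (f(A) / g(A))`, with `0 log 0 = 0`. -/
noncomputable def partitionDiv (π : List (Cell p q)) (f g : Cell p q → ℝ) : ℝ :=
  (π.map fun A => f A * Real.log (f A / g A)).sum

/-- The product `Q*` of the marginals of `P`. -/
noncomputable def prodMarginals (P : Measure (Obs p q)) : Measure (Obs p q) :=
  (P.map Prod.fst).prod (P.map Prod.snd)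

/-- `D_{σ(π)}(P‖Q*)`. -/
noncomputable def trueDiv (P : Measure (Obs p q)) (π : List (Cell p q)) : ℝ :=
  partitionDiv π (fun A => P.real A.toSet) (fun A => (prodMarginals P).real A.toSet)

/-- `D_{σ(π)}(P̂ₙ‖Q̂*ₙ)`. -/
noncomputable def empDiv (z : Fin n → Obs p q) (π : List (Cell p q)) : ℝ :=
  partitionDiv π (empP z) (empQ z)

/-- The mutual information `I(X;Y) = D(P‖Q*)`, possibly infinite. -/
noncomputable def mutualInfo (P : Measure (Obs p q)) : ENNReal :=
  InformationTheory.klDiv P (prodMarginals P)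

open Classical in
/-- The quantizer `O_π(z) = ∑_j j · 1_{A_j}(z)`, with cells numbered from `1`. -/
noncomputable def quantize (π : List (Cell p q)) (w : Obs p q) : ℕ :=
  ∑ j : Fin π.length, if w ∈ (π.get j).toSet then (j : ℕ) + 1 else 0

/-- The cell numbered `o ∈ {1, …, |π|}`. -/
def cellNumber (π : List (Cell p q)) (o : ℕ) : Cell p q := π.getD (o - 1) (Cell.root p q)

/-- The empirical information
`î_π(o₁,…,oₙ) = (1/n) log (∏ P̂_O(o_i) / ∏ Q̂_O(o_i))` at the projected data `o_i = O_π(z_i)`. -/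
noncomputable def empInfo (z : Fin n → Obs p q) (π : List (Cell p q)) : ℝ :=
  1 / (n : ℝ) * Real.log
    ((∏ i, empP z (cellNumber π (quantize π (z i)))) /
      ∏ i, empQ z (cellNumber π (quantize π (z i))))

/-- The oracle information `i_n(z₁,…,zₙ) = (1/n) log ∏ dP/dQ*(z_i)`. -/
noncomputable def oracleInfo (P : Measure (Obs p q)) (z : Fin n → Obs p q) : ℝ :=
  1 / (n : ℝ) * Real.log (∏ i, (P.rnDeriv (prodMarginals P) (z i)).toReal)

/-- The confidence width `ε_c(n, b, d, δ, k)`. -/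
noncomputable def confWidth (n : ℕ) (b : ℝ) (d : ℕ) (δ : ℝ) (k : ℕ) : ℝ :=
  24 * Real.sqrt 2 / (b * Real.sqrt n) *
    Real.sqrt (Real.log (8 / δ) + k * ((d + 1) * Real.log 2 + d * Real.log n))

/-- The penalty `r_{b,δ}(k) = ε_c(n, b, d, δ b, k)`, where `r_{b,δ}(1) = 0`, since there is nothing
to estimate on the trivial partition. -/
noncomputable def penalty (n : ℕ) (b : ℝ) (d : ℕ) (δ : ℝ) (k : ℕ) : ℝ :=
  if k = 1 then 0 else confWidth n b d (δ * b) k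

/-- The objective of the regularized empirical information maximization. -/
noncomputable def objective (c : CoordRule p q n) (z : Fin n → Obs p q) (b δ : ℝ)
    (T : BinTree) : ℝ :=
  empDiv z (treePartition c z T) - penalty n b (p + q) δ T.size

/-- `T` is a solution `T̂_{b,δ}` of the regularized empirical information maximization over the
pruned versions of the full tree. -/
def IsSolution (c : CoordRule p q n) (z : Fin n → Obs p q) (b δ : ℝ) (T : BinTree) : Prop :=
  T.Prunes (fullTree c z b) ∧
    ∀ T' : BinTree, T'.Prunes (fullTree c z b) → objective c z b δ T' ≤ objective c z b δ T

theorem exists_isSolution (c : CoordRule p q n) (z : Fin n → Obs p q) (b δ : ℝ) :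
    ∃ T, IsSolution c z b δ T := by
  obtain ⟨T, hT, h⟩ := (fullTree c z b).prunings.exists_max_image (objective c z b δ)
    (fullTree c z b).prunings_nonempty
  exact ⟨T, (BinTree.mem_prunings _ _).mp hT,
    fun T' hT' => h T' ((BinTree.mem_prunings _ _).mpr hT')⟩

/-- The oracle trade-off
`min_{T ≪ T^full_b} [D(P‖Q*) - D_{σ(π_T)}(P‖Q*) + 2 r_{b,δ}(|T|)]`, for `D(P‖Q*) < ∞`. -/
noncomputable def oracleTradeoff (P : Measure (Obs p q)) (c : CoordRule p q n)
    (z : Fin n → Obs p q) (b δ : ℝ) : ℝ :=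
  (fullTree c z b).prunings.inf' (fullTree c z b).prunings_nonempty fun T =>
    ((mutualInfo P).toReal - trueDiv P (treePartition c z T)) +
      2 * penalty n b (p + q) δ T.size

/-- Zero regret by structure: every solution is the tree with one cell, and the empirical
information equals the oracle information, and both vanish. -/
def ZeroRegret (P : Measure (Obs p q)) (c : CoordRule p q n) (z : Fin n → Obs p q)
    (b δ : ℝ) : Prop :=
  ∀ T, IsSolution c z b δ T →
    treePartition c z T = [Cell.root p q] ∧
    empInfo z (treePartition c z T) = oracleInfo P z ∧ oracleInfo P z = 0

/-- The regret of every solution is at most `i_n - I(X;Y)` plus the oracle trade-off. -/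
def RegretBound (P : Measure (Obs p q)) (c : CoordRule p q n) (z : Fin n → Obs p q)
    (b δ : ℝ) : Prop :=
  ∀ T, IsSolution c z b δ T →
    oracleInfo P z - empInfo z (treePartition c z T) ≤
      oracleInfo P z - (mutualInfo P).toReal + oracleTradeoff P c z b δ

end Information

end TSP

/-! Everything reduces to one uniform deviation event. A median is a coordinate of a sample point,
so every cell of every pruned tree is a box whose finite end points are sample coordinates. However
the splitting coordinates depend on the data, a cell is determined by at most one sample index per
side and coordinate, hence by one of `(n + 1) ^ (2 * d)` codes. For `k` fixed codes the union of the
boxes depends on at most `2 * k * d` sample points; given these, Hoeffding's inequality applies to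
the others (`pi_measure_abs_sum_dependent_gt_le`). A union bound over codes and over `k ≤ 1 / b`
shows that, outside probability `δ`, all unions of `k` boxes deviate by at most `t = b * w / 6`,
where `w` is the penalty for `k` cells.

On this event, let all `k` cells have empirical mass at least `b`, so that `k * b ≤ 1`. Elementary
bounds on logarithms give that the true divergence exceeds the empirical one by at most `5 * t / b <
w` (`sum_mul_log_sub_le`), and that under independence the empirical divergence is at most `4 * t /
b < w` (`sum_mul_log_le_of_eq_mul`).

Under independence every nontrivial tree therefore has negative objective, while the root has
objective zero. In general, optimality of `T` against a competitor `T'` costs one penalty of `T'`,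
and passing from the empirical to the true divergence of `T'` costs a second one. The penalty of `T`
is simply dropped, so no deviation bound for `T` itself is needed. -/

namespace TSP

/-! ### Deterministic perturbation bounds for divergence sums -/

section LogBounds

/-- From `log s ≤ s - 1`. The condition `x ≤ c` cancels the denominator, so the bound does not
degrade when `c` is small. -/
theorem mul_log_div_le {x a c : ℝ} (ha : 0 < a) (hc : 0 < c) (hx : 0 ≤ x) (hxc : x ≤ c) :
    x * Real.log (a / c) ≤ max (a - c) 0 := by
  have h1 : Real.log (a / c) ≤ a / c - 1 := Real.log_le_sub_one_of_pos (div_pos ha hc)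
  rcases le_total a c with h | h
  · have : Real.log (a / c) ≤ 0 := by
      refine Real.log_nonpos (div_pos ha hc).le ((div_le_one hc).mpr h)
    exact le_trans (mul_nonpos_of_nonneg_of_nonpos hx this) (le_max_right _ _)
  · refine le_trans ?_ (le_max_left _ _)
    have h2 : 0 ≤ a / c - 1 := by
      rw [sub_nonneg]; exact (one_le_div hc).mpr h
    calc x * Real.log (a / c) ≤ x * (a / c - 1) := mul_le_mul_of_nonneg_left h1 hx
      _ ≤ c * (a / c - 1) := mul_le_mul_of_nonneg_right hxc h2
      _ = a - c := by field_simp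

theorem abs_log_div_le {x y b : ℝ} (hb : 0 < b) (hx : b ≤ x) (hy : x * x ≤ y)
    (hy1 : y ≤ 1) : |Real.log (x / y)| ≤ 1 / b := by
  have hx0 : 0 < x := hb.trans_le hx
  have hy0 : 0 < y := lt_of_lt_of_le (mul_pos hx0 hx0) hy
  have h1 : x / y ≤ 1 / b := by
    rw [div_le_div_iff₀ hy0 hb]; nlinarith
  have h2 : y / x ≤ 1 / b := by
    rw [div_le_div_iff₀ hx0 hb]; nlinarith
  rw [abs_le]
  constructor
  · have := Real.log_le_sub_one_of_pos (div_pos hy0 hx0)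
    have h3 : Real.log (y / x) = - Real.log (x / y) := by
      rw [← Real.log_inv, inv_div]
    linarith
  · have := Real.log_le_sub_one_of_pos (div_pos hx0 hy0)
    linarith

variable {ι : Type*} [Fintype ι]

-- The positive parts add up to the deviation on the single set of indices with `u j ≤ x j`.
-- Controlling unions thus costs `t` once, where controlling the cells one by one would cost `t` per
-- cell.
open Classical in
theorem sum_posPart_le {x u : ι → ℝ} {t : ℝ}
    (hJ : ∀ J : Finset ι, |∑ j ∈ J, x j - ∑ j ∈ J, u j| ≤ t) :
    ∑ j, max (x j - u j) 0 ≤ t := by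
  have h := le_of_abs_le (hJ (Finset.univ.filter fun j => u j ≤ x j))
  rw [← Finset.sum_sub_distrib] at h
  refine le_trans (le_of_eq ?_) h
  rw [Finset.sum_filter]
  refine Finset.sum_congr rfl fun j _ => ?_
  split_ifs with hj
  · exact max_eq_left (by linarith)
  · exact max_eq_right (by linarith)

theorem sum_posPart_le' {x u : ι → ℝ} {t : ℝ}
    (hJ : ∀ J : Finset ι, |∑ j ∈ J, x j - ∑ j ∈ J, u j| ≤ t) :
    ∑ j, max (u j - x j) 0 ≤ t :=
  sum_posPart_le fun J => by rw [abs_sub_comm]; exact hJ J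

/-- Here `x, y₁, y₂` are empirical masses of cells and their marginals, and `u, v₁, v₂` the true
ones. Only the empirical masses are bounded below, so the logarithm carrying the difference `u - x`
is the empirical one, of size at most `1 / b`. -/
theorem sum_mul_log_sub_le {x u y₁ y₂ v₁ v₂ : ι → ℝ} {b t : ℝ} (hb : 0 < b) (ht : 0 ≤ t)
    (hk : Fintype.card ι * b ≤ 1)
    (hx : ∀ j, b ≤ x j) (hxy₁ : ∀ j, x j ≤ y₁ j) (hxy₂ : ∀ j, x j ≤ y₂ j)
    (hy₁ : ∀ j, y₁ j ≤ 1) (hy₂ : ∀ j, y₂ j ≤ 1)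
    (hu : ∀ j, 0 ≤ u j) (huv₁ : ∀ j, u j ≤ v₁ j) (huv₂ : ∀ j, u j ≤ v₂ j) (hu1 : ∀ j, u j ≤ 1)
    (hJ : ∀ J : Finset ι, |∑ j ∈ J, x j - ∑ j ∈ J, u j| ≤ t)
    (h₁ : ∀ j, |y₁ j - v₁ j| ≤ t) (h₂ : ∀ j, |y₂ j - v₂ j| ≤ t) :
    ∑ j, u j * Real.log (u j / (v₁ j * v₂ j)) - ∑ j, x j * Real.log (x j / (y₁ j * y₂ j))
      ≤ 5 * t / b := by
  have key : ∀ j, u j * Real.log (u j / (v₁ j * v₂ j)) - x j * Real.log (x j / (y₁ j * y₂ j))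
      ≤ 1 / b * (max (x j - u j) 0 + 2 * max (u j - x j) 0) + 2 * t := by
    intro j
    have hx0 : 0 < x j := hb.trans_le (hx j)
    have hy10 : 0 < y₁ j := hx0.trans_le (hxy₁ j)
    have hy20 : 0 < y₂ j := hx0.trans_le (hxy₂ j)
    have hx1 : x j ≤ 1 := (hxy₁ j).trans (hy₁ j)
    have hlog := abs_log_div_le hb (hx j)
      (mul_le_mul (hxy₁ j) (hxy₂ j) hx0.le hy10.le) (mul_le_one₀ (hy₁ j) hy20.le (hy₂ j))
    have hb1 : 0 < 1 / b := by positivity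
    have hfirst : (u j - x j) * Real.log (x j / (y₁ j * y₂ j))
        ≤ 1 / b * (max (x j - u j) 0 + max (u j - x j) 0) := by
      have habs : |u j - x j| = max (x j - u j) 0 + max (u j - x j) 0 := by
        rcases le_total (u j) (x j) with h | h
        · rw [abs_of_nonpos (by linarith), max_eq_left (by linarith), max_eq_right (by linarith)]
          ring
        · rw [abs_of_nonneg (by linarith), max_eq_right (by linarith), max_eq_left (by linarith)]
          ring
      rw [← habs, mul_comm (1 / b)]
      refine (le_abs_self _).trans ?_
      rw [abs_mul]
      exact mul_le_mul_of_nonneg_left hlog (abs_nonneg _)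
    -- A cell may have true mass zero; the logarithms can be split only when `u j` is positive.
    rcases (hu j).eq_or_lt with h0 | h0
    · rw [← h0] at hfirst ⊢
      have : 0 ≤ 1 / b * max (0 - x j) 0 := mul_nonneg hb1.le (le_max_right _ _)
      simp only [zero_mul] at *
      linarith
    · have hv1 : 0 < v₁ j := h0.trans_le (huv₁ j)
      have hv2 : 0 < v₂ j := h0.trans_le (huv₂ j)
      have e : u j * Real.log (u j / (v₁ j * v₂ j)) - x j * Real.log (x j / (y₁ j * y₂ j))
          = (u j - x j) * Real.log (x j / (y₁ j * y₂ j)) + u j * Real.log (u j / x j)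
            + u j * Real.log (y₁ j / v₁ j) + u j * Real.log (y₂ j / v₂ j) := by
        rw [Real.log_div h0.ne' (by positivity), Real.log_div hx0.ne' (by positivity),
          Real.log_mul hv1.ne' hv2.ne', Real.log_mul hy10.ne' hy20.ne',
          Real.log_div h0.ne' hx0.ne', Real.log_div hy10.ne' hv1.ne',
          Real.log_div hy20.ne' hv2.ne']
        ring
      have e1 : u j * Real.log (u j / x j) ≤ 1 / b * max (u j - x j) 0 := by
        -- The weight `u j` may exceed `x j`, so the bound is applied to the weight `x j * u j ≤ x
        -- j` and divided by `x j ≥ b` afterwards.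
        have h3 := mul_log_div_le (x := x j * u j) h0 hx0 (by positivity)
          (mul_le_of_le_one_right hx0.le (hu1 j))
        have h4 : u j * Real.log (u j / x j) = 1 / x j * (x j * u j * Real.log (u j / x j)) := by
          field_simp
        rw [h4]
        calc 1 / x j * (x j * u j * Real.log (u j / x j)) ≤ 1 / x j * max (u j - x j) 0 :=
              mul_le_mul_of_nonneg_left h3 (by positivity)
          _ ≤ 1 / b * max (u j - x j) 0 :=
              mul_le_mul_of_nonneg_right (one_div_le_one_div_of_le hb (hx j)) (le_max_right _ _)
      have e2 := (mul_log_div_le hy10 hv1 h0.le (huv₁ j)).trans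
        (max_le ((le_abs_self _).trans (h₁ j)) ht)
      have e3 := (mul_log_div_le hy20 hv2 h0.le (huv₂ j)).trans
        (max_le ((le_abs_self _).trans (h₂ j)) ht)
      rw [e]
      linarith
  rw [← Finset.sum_sub_distrib]
  refine (Finset.sum_le_sum fun j _ => key j).trans ?_
  rw [Finset.sum_add_distrib, ← Finset.mul_sum, Finset.sum_add_distrib, ← Finset.mul_sum,
    Finset.sum_const, Finset.card_univ, nsmul_eq_mul]
  have p1 := sum_posPart_le hJ
  have p2 := sum_posPart_le' hJ
  rw [le_div_iff₀ hb, add_mul]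
  have e : 1 / b * (∑ j, max (x j - u j) 0 + 2 * ∑ j, max (u j - x j) 0) * b
      = ∑ j, max (x j - u j) 0 + 2 * ∑ j, max (u j - x j) 0 := by field_simp
  rw [e]
  -- After multiplication by `b` the terms are `t + 2 * t` from the positive parts and `2 * t * (k *
  -- b) ≤ 2 * t` from the marginals.
  nlinarith [mul_le_mul_of_nonneg_right hk ht]

/-- The product structure of `u` makes the true logarithm vanish, so comparing `x` with `u` and each
`yᵢ` with `vᵢ` accounts for the whole sum. -/
theorem sum_mul_log_le_of_eq_mul {x u y₁ y₂ v₁ v₂ : ι → ℝ} {b t : ℝ} (hb : 0 < b) (hb1 : b ≤ 1)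
    (ht : 0 ≤ t) (hk : Fintype.card ι * b ≤ 1)
    (hx : ∀ j, b ≤ x j) (hxy₁ : ∀ j, x j ≤ y₁ j) (hxy₂ : ∀ j, x j ≤ y₂ j)
    (hy₁ : ∀ j, y₁ j ≤ 1) (hy₂ : ∀ j, y₂ j ≤ 1)
    (hv₁ : ∀ j, 0 ≤ v₁ j) (hv₂ : ∀ j, 0 ≤ v₂ j) (huv : ∀ j, u j = v₁ j * v₂ j)
    (hJ : ∀ J : Finset ι, |∑ j ∈ J, x j - ∑ j ∈ J, u j| ≤ t)
    (h₁ : ∀ j, |y₁ j - v₁ j| ≤ t) (h₂ : ∀ j, |y₂ j - v₂ j| ≤ t) :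
    ∑ j, x j * Real.log (x j / (y₁ j * y₂ j)) ≤ 4 * t / b := by
  have hbb : 1 ≤ 1 / b := (one_le_div hb).mpr hb1
  have key : ∀ j, x j * Real.log (x j / (y₁ j * y₂ j))
      ≤ 2 / b * max (x j - u j) 0 + 2 * t := by
    intro j
    have hx0 : 0 < x j := hb.trans_le (hx j)
    have hy10 : 0 < y₁ j := hx0.trans_le (hxy₁ j)
    have hy20 : 0 < y₂ j := hx0.trans_le (hxy₂ j)
    have hx1 : x j ≤ 1 := (hxy₁ j).trans (hy₁ j)
    have hlog := abs_log_div_le hb (hx j)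
      (mul_le_mul (hxy₁ j) (hxy₂ j) hx0.le hy10.le) (mul_le_one₀ (hy₁ j) hy20.le (hy₂ j))
    have hm := le_max_left (x j - u j) 0
    have hm0 := le_max_right (x j - u j) 0
    -- If `u` is below half of `x`, then `x ≤ 2 * (x - u)` and the crude bound `1 / b` on the
    -- logarithm suffices. Otherwise `x / 2 ≤ u`, which is the weight condition of `mul_log_div_le`
    -- with denominator `u`.
    rcases lt_or_ge (2 * u j) (x j) with h | h
    · calc x j * Real.log (x j / (y₁ j * y₂ j)) ≤ x j * (1 / b) :=
            mul_le_mul_of_nonneg_left (le_of_abs_le hlog) hx0.le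
        _ ≤ (2 * max (x j - u j) 0) * (1 / b) :=
            mul_le_mul_of_nonneg_right (by linarith) (by positivity)
        _ = 2 / b * max (x j - u j) 0 := by ring
        _ ≤ _ := by linarith
    · have hu0 : 0 < u j := by linarith
      have hv1 : 0 < v₁ j := (hv₁ j).lt_of_ne fun h => by rw [huv, ← h, zero_mul] at hu0; simp at hu0
      have hv2 : 0 < v₂ j := (hv₂ j).lt_of_ne fun h => by rw [huv, ← h, mul_zero] at hu0; simp at hu0
      have e : x j * Real.log (x j / (y₁ j * y₂ j))
          = 2 * (x j / 2 * Real.log (x j / u j)) + x j * Real.log (v₁ j / y₁ j)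
            + x j * Real.log (v₂ j / y₂ j) := by
        rw [huv, Real.log_div hx0.ne' (by positivity), Real.log_div hx0.ne' (by positivity),
          Real.log_mul hv1.ne' hv2.ne', Real.log_mul hy10.ne' hy20.ne',
          Real.log_div hv1.ne' hy10.ne', Real.log_div hv2.ne' hy20.ne']
        ring
      have e1 := mul_log_div_le (x := x j / 2) hx0 hu0 (by positivity) (by linarith)
      have e2 := (mul_log_div_le hv1 hy10 hx0.le (hxy₁ j)).trans
        (max_le ((le_abs_self _).trans ((abs_sub_comm _ _).trans_le (h₁ j))) ht)
      have e3 := (mul_log_div_le hv2 hy20 hx0.le (hxy₂ j)).trans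
        (max_le ((le_abs_self _).trans ((abs_sub_comm _ _).trans_le (h₂ j))) ht)
      have e4 : 2 * max (x j - u j) 0 ≤ 2 / b * max (x j - u j) 0 := by
        refine mul_le_mul_of_nonneg_right ?_ hm0
        rw [show 2 / b = 2 * (1 / b) by ring]; linarith
      rw [e]
      linarith
  refine (Finset.sum_le_sum fun j _ => key j).trans ?_
  rw [Finset.sum_add_distrib, ← Finset.mul_sum, Finset.sum_const, Finset.card_univ, nsmul_eq_mul]
  have p1 := sum_posPart_le hJ
  rw [le_div_iff₀ hb, add_mul]
  have e : 2 / b * (∑ j, max (x j - u j) 0) * b = 2 * ∑ j, max (x j - u j) 0 := by field_simp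
  rw [e]
  nlinarith [mul_le_mul_of_nonneg_right hk ht]

end LogBounds

/-! ### The empirical measure -/

section EmpiricalMeasure

variable {p q n : ℕ}

theorem mem_pointsIn {z : Fin n → Obs p q} {S : Set (Obs p q)} {i : Fin n} :
    i ∈ pointsIn z S ↔ z i ∈ S := by
  classical
  simp [pointsIn]

theorem empProb_nonneg (z : Fin n → Obs p q) (S : Set (Obs p q)) : 0 ≤ empProb z S := by
  unfold empProb; positivity

theorem empProb_mono (z : Fin n → Obs p q) {S T : Set (Obs p q)} (h : S ⊆ T) :
    empProb z S ≤ empProb z T := by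
  unfold empProb
  gcongr
  intro i hi
  rw [mem_pointsIn] at *
  exact h hi

theorem empProb_univ (hn : n ≠ 0) (z : Fin n → Obs p q) : empProb z Set.univ = 1 := by
  have : pointsIn z (Set.univ : Set (Obs p q)) = Finset.univ := by
    ext i; simp [mem_pointsIn]
  rw [empProb, this, Finset.card_univ, Fintype.card_fin, div_self (by exact_mod_cast hn)]

theorem empProb_le_one (z : Fin n → Obs p q) (S : Set (Obs p q)) : empProb z S ≤ 1 := by
  rcases eq_or_ne n 0 with rfl | hn
  · simp [empProb]
  · exact (empProb_mono z (Set.subset_univ S)).trans_eq (empProb_univ hn z)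

open Classical in
theorem empProb_eq_sum (z : Fin n → Obs p q) (S : Set (Obs p q)) :
    empProb z S = (∑ i, S.indicator (fun _ => (1 : ℝ)) (z i)) / n := by
  simp [empProb, pointsIn, Set.indicator_apply, Finset.sum_boole]

theorem empProb_pos {z : Fin n → Obs p q} {S : Set (Obs p q)} {i : Fin n} (h : z i ∈ S) :
    0 < empProb z S := by
  have hn : 0 < n := i.pos
  have : 0 < (pointsIn z S).card := Finset.card_pos.mpr ⟨i, mem_pointsIn.mpr h⟩
  unfold empProb
  positivity

open Classical in
theorem empProb_biUnion {ι : Type*} (z : Fin n → Obs p q) (J : Finset ι) (S : ι → Set (Obs p q))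
    (hS : Pairwise (Function.onFun Disjoint S)) :
    empProb z (⋃ j ∈ J, S j) = ∑ j ∈ J, empProb z (S j) := by
  have : pointsIn z (⋃ j ∈ J, S j) = J.biUnion fun j => pointsIn z (S j) := by
    ext i; simp [mem_pointsIn]
  unfold empProb
  rw [this, Finset.card_biUnion, Nat.cast_sum, Finset.sum_div]
  intro j _ j' _ hj
  rw [Function.onFun, Finset.disjoint_left]
  intro i hi hi'
  rw [mem_pointsIn] at hi hi'
  exact Set.disjoint_left.mp (hS hj) hi hi'

theorem empP_le_fst (z : Fin n → Obs p q) (A : Cell p q) :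
    empP z A ≤ empProb z (A.fst ×ˢ Set.univ) :=
  empProb_mono z (Set.prod_mono_right (Set.subset_univ _))

theorem empP_le_snd (z : Fin n → Obs p q) (A : Cell p q) :
    empP z A ≤ empProb z (Set.univ ×ˢ A.snd) :=
  empProb_mono z (Set.prod_mono_left (Set.subset_univ _))

end EmpiricalMeasure

/-! ### Boxes with end points in the sample -/

section Boxes

variable {p q n : ℕ}

/-- For each coordinate, the indices of the sample points that give a lower and an upper bound. -/
abbrev BoxCode (p q n : ℕ) : Type := Fin p ⊕ Fin q → Option (Fin n) × Option (Fin n)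

/-- The half-open interval of the `j`-th coordinate whose end points are coordinates of sample
points. -/
def sampleInterval (z : Fin n → Obs p q) (j : Fin p ⊕ Fin q)
    (o : Option (Fin n) × Option (Fin n)) : Set ℝ :=
  {x | (∀ i ∈ o.1, coordVal j (z i) < x) ∧ ∀ i ∈ o.2, x ≤ coordVal j (z i)}

/-- The product of the intervals of a code. -/
def boxCell (z : Fin n → Obs p q) (κ : BoxCode p q n) : Cell p q :=
  ⟨{x | ∀ i, x i ∈ sampleInterval z (Sum.inl i) (κ (Sum.inl i))},
    {y | ∀ i, y i ∈ sampleInterval z (Sum.inr i) (κ (Sum.inr i))}⟩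

theorem mem_boxCell_toSet {z : Fin n → Obs p q} {κ : BoxCode p q n} {w : Obs p q} :
    w ∈ (boxCell z κ).toSet ↔ ∀ j, coordVal j w ∈ sampleInterval z j (κ j) := by
  rw [Sum.forall]
  rfl

theorem Cell.mem_lower_toSet {A : Cell p q} {j : Fin p ⊕ Fin q} {t : ℝ} {w : Obs p q} :
    w ∈ (A.lower j t).toSet ↔ w ∈ A.toSet ∧ coordVal j w ≤ t := by
  cases j <;> simp [Cell.lower, Cell.toSet, coordVal] <;> tauto

theorem Cell.mem_upper_toSet {A : Cell p q} {j : Fin p ⊕ Fin q} {t : ℝ} {w : Obs p q} :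
    w ∈ (A.upper j t).toSet ↔ w ∈ A.toSet ∧ t < coordVal j w := by
  cases j <;> simp [Cell.upper, Cell.toSet, coordVal] <;> tauto

theorem sampleInterval_none (z : Fin n → Obs p q) (j : Fin p ⊕ Fin q) :
    sampleInterval z j (none, none) = Set.univ := by
  simp [sampleInterval]

theorem root_eq_boxCell (z : Fin n → Obs p q) :
    Cell.root p q = boxCell z fun _ => (none, none) := by
  simp [Cell.root, boxCell, sampleInterval_none]

theorem boxCell_fst_prod_univ (z : Fin n → Obs p q) (κ : BoxCode p q n) :
    (boxCell z κ).fst ×ˢ Set.univ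
      = (boxCell z (Sum.elim (κ ∘ Sum.inl) fun _ => (none, none))).toSet := by
  simp [Cell.toSet, boxCell, sampleInterval_none]

theorem boxCell_univ_prod_snd (z : Fin n → Obs p q) (κ : BoxCode p q n) :
    Set.univ ×ˢ (boxCell z κ).snd
      = (boxCell z (Sum.elim (fun _ => (none, none)) (κ ∘ Sum.inr))).toSet := by
  simp [Cell.toSet, boxCell, sampleInterval_none]

/-- Of two upper end points only the smaller matters, so one index per side suffices however often a
coordinate is split. This keeps the number of codes independent of the depth. -/
theorem exists_sampleInterval_inter_Iic (z : Fin n → Obs p q) (j : Fin p ⊕ Fin q)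
    (o : Option (Fin n) × Option (Fin n)) (i : Fin n) :
    ∃ o', sampleInterval z j o' = sampleInterval z j o ∩ Set.Iic (coordVal j (z i)) := by
  obtain ⟨o₁, _ | i'⟩ := o
  · exact ⟨(o₁, some i), by ext x; simp [sampleInterval]⟩
  · rcases le_total (coordVal j (z i)) (coordVal j (z i')) with h | h
    · refine ⟨(o₁, some i), ?_⟩
      ext x
      simp only [sampleInterval, Option.mem_def, Option.some.injEq, forall_eq', Set.mem_inter_iff,
        Set.mem_ofPred_eq, Set.mem_Iic]
      exact ⟨fun H => ⟨⟨H.1, H.2.trans h⟩, H.2⟩, fun H => ⟨H.1.1, H.2⟩⟩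
    · refine ⟨(o₁, some i'), ?_⟩
      ext x
      simp only [sampleInterval, Option.mem_def, Option.some.injEq, forall_eq', Set.mem_inter_iff,
        Set.mem_ofPred_eq, Set.mem_Iic]
      exact ⟨fun H => ⟨H, H.2.trans h⟩, fun H => H.1⟩

theorem exists_sampleInterval_inter_Ioi (z : Fin n → Obs p q) (j : Fin p ⊕ Fin q)
    (o : Option (Fin n) × Option (Fin n)) (i : Fin n) :
    ∃ o', sampleInterval z j o' = sampleInterval z j o ∩ Set.Ioi (coordVal j (z i)) := by
  obtain ⟨_ | i', o₂⟩ := o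
  · exact ⟨(some i, o₂), by ext x; simp [sampleInterval, and_comm]⟩
  · rcases le_total (coordVal j (z i)) (coordVal j (z i')) with h | h
    · refine ⟨(some i', o₂), ?_⟩
      ext x
      simp only [sampleInterval, Option.mem_def, Option.some.injEq, forall_eq', Set.mem_inter_iff,
        Set.mem_ofPred_eq, Set.mem_Ioi]
      exact ⟨fun H => ⟨H, h.trans_lt H.1⟩, fun H => H.1⟩
    · refine ⟨(some i, o₂), ?_⟩
      ext x
      simp only [sampleInterval, Option.mem_def, Option.some.injEq, forall_eq', Set.mem_inter_iff,
        Set.mem_ofPred_eq, Set.mem_Ioi]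
      exact ⟨fun H => ⟨⟨h.trans_lt H.1, H.2⟩, H.1⟩, fun H => ⟨H.2, H.1.2⟩⟩

theorem boxCell_update_inl (z : Fin n → Obs p q) (κ : BoxCode p q n) (i : Fin p)
    (o' : Option (Fin n) × Option (Fin n)) (S : Set ℝ)
    (h : sampleInterval z (Sum.inl i) o' = sampleInterval z (Sum.inl i) (κ (Sum.inl i)) ∩ S) :
    boxCell z (Function.update κ (Sum.inl i) o')
      = ⟨(boxCell z κ).fst ∩ {x | x i ∈ S}, (boxCell z κ).snd⟩ := by
  simp only [boxCell, Cell.mk.injEq]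
  constructor
  · ext x
    simp only [Set.mem_inter_iff, Set.mem_ofPred_eq]
    constructor
    · intro H
      have hi := H i
      rw [Function.update_self, h] at hi
      refine ⟨fun i' => ?_, hi.2⟩
      by_cases e : i' = i
      · subst e; exact hi.1
      · have := H i'
        rwa [Function.update_of_ne (by simpa using e)] at this
    · rintro ⟨H, hS⟩ i'
      by_cases e : i' = i
      · subst e
        rw [Function.update_self, h]
        exact ⟨H i', hS⟩
      · rw [Function.update_of_ne (by simpa using e)]
        exact H i'
  · simp

theorem boxCell_update_inr (z : Fin n → Obs p q) (κ : BoxCode p q n) (i : Fin q)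
    (o' : Option (Fin n) × Option (Fin n)) (S : Set ℝ)
    (h : sampleInterval z (Sum.inr i) o' = sampleInterval z (Sum.inr i) (κ (Sum.inr i)) ∩ S) :
    boxCell z (Function.update κ (Sum.inr i) o')
      = ⟨(boxCell z κ).fst, (boxCell z κ).snd ∩ {y | y i ∈ S}⟩ := by
  simp only [boxCell, Cell.mk.injEq]
  constructor
  · simp
  · ext x
    simp only [Set.mem_inter_iff, Set.mem_ofPred_eq]
    constructor
    · intro H
      have hi := H i
      rw [Function.update_self, h] at hi
      refine ⟨fun i' => ?_, hi.2⟩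
      by_cases e : i' = i
      · subst e; exact hi.1
      · have := H i'
        rwa [Function.update_of_ne (by simpa using e)] at this
    · rintro ⟨H, hS⟩ i'
      by_cases e : i' = i
      · subst e
        rw [Function.update_self, h]
        exact ⟨H i', hS⟩
      · rw [Function.update_of_ne (by simpa using e)]
        exact H i'

theorem exists_lower_boxCell (z : Fin n → Obs p q) (κ : BoxCode p q n) (j : Fin p ⊕ Fin q)
    (i : Fin n) : ∃ κ', (boxCell z κ).lower j (coordVal j (z i)) = boxCell z κ' := by
  obtain ⟨o', ho'⟩ := exists_sampleInterval_inter_Iic z j (κ j) i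
  refine ⟨Function.update κ j o', ?_⟩
  cases j with
  | inl j => exact (boxCell_update_inl z κ j o' _ ho').symm
  | inr j => exact (boxCell_update_inr z κ j o' _ ho').symm

theorem exists_upper_boxCell (z : Fin n → Obs p q) (κ : BoxCode p q n) (j : Fin p ⊕ Fin q)
    (i : Fin n) : ∃ κ', (boxCell z κ).upper j (coordVal j (z i)) = boxCell z κ' := by
  obtain ⟨o', ho'⟩ := exists_sampleInterval_inter_Ioi z j (κ j) i
  refine ⟨Function.update κ j o', ?_⟩
  cases j with
  | inl j => exact (boxCell_update_inl z κ j o' _ ho').symm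
  | inr j => exact (boxCell_update_inr z κ j o' _ ho').symm

theorem exists_cellMedian_eq {z : Fin n → Obs p q} {A : Cell p q} (j : Fin p ⊕ Fin q)
    (h : (pointsIn z A.toSet).Nonempty) : ∃ i, cellMedian z A j = coordVal j (z i) := by
  have hc := Finset.card_pos.mpr h
  -- The zero-based rank is in range because the cell contains a point; hence the default value `0`
  -- in `cellMedian` is never used.
  have hlen : (((pointsIn z A.toSet).card - 1) / 2)
      < (((pointsIn z A.toSet).val.map fun i => coordVal j (z i)).sort (· ≤ ·)).length := by
    rw [Multiset.length_sort, Multiset.card_map, Finset.card_val]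
    omega
  have hmem := List.getElem_mem hlen
  rw [Multiset.mem_sort, Multiset.mem_map] at hmem
  obtain ⟨i, -, hi⟩ := hmem
  refine ⟨i, ?_⟩
  rw [cellMedian, List.getD_eq_getElem _ _ hlen, ← hi]

end Boxes

/-! ### Leaf cells of pruned trees: partition, box shape, mass -/

section LeafCells

variable {p q n : ℕ}

theorem toSet_leftCell_subset (z : Fin n → Obs p q) (j : Fin p ⊕ Fin q) (A : Cell p q) :
    (leftCell z j A).toSet ⊆ A.toSet := fun _ hw => (Cell.mem_lower_toSet.mp hw).1

theorem toSet_rightCell_subset (z : Fin n → Obs p q) (j : Fin p ⊕ Fin q) (A : Cell p q) :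
    (rightCell z j A).toSet ⊆ A.toSet := fun _ hw => (Cell.mem_upper_toSet.mp hw).1

theorem length_leafCells (c : CoordRule p q n) (z : Fin n → Obs p q) (T : BinTree)
    (v : List Bool) (A : Cell p q) : (leafCells c z T v A).length = T.size := by
  induction T generalizing v A with
  | leaf => rfl
  | node l r ihl ihr => simp [leafCells, BinTree.size, ihl, ihr]

theorem length_treePartition (c : CoordRule p q n) (z : Fin n → Obs p q) (T : BinTree) :
    (treePartition c z T).length = T.size :=
  length_leafCells c z T _ _

theorem subset_of_mem_leafCells {c : CoordRule p q n} {z : Fin n → Obs p q} {T : BinTree}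
    {v : List Bool} {A B : Cell p q} (hB : B ∈ leafCells c z T v A) : B.toSet ⊆ A.toSet := by
  induction T generalizing v A with
  | leaf => rw [leafCells, List.mem_singleton] at hB; rw [hB]
  | node l r ihl ihr =>
    rw [leafCells, List.mem_append] at hB
    rcases hB with hB | hB
    · exact (ihl hB).trans (toSet_leftCell_subset _ _ _)
    · exact (ihr hB).trans (toSet_rightCell_subset _ _ _)

theorem exists_mem_leafCells (c : CoordRule p q n) (z : Fin n → Obs p q) (T : BinTree)
    (v : List Bool) {A : Cell p q} {w : Obs p q} (hw : w ∈ A.toSet) :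
    ∃ B ∈ leafCells c z T v A, w ∈ B.toSet := by
  induction T generalizing v A with
  | leaf => exact ⟨A, by simp [leafCells], hw⟩
  | node l r ihl ihr =>
    rcases le_or_gt (coordVal (c z v) w) (cellMedian z A (c z v)) with h | h
    · obtain ⟨B, hB, hwB⟩ := ihl (v ++ [false]) (A := leftCell z (c z v) A)
        (Cell.mem_lower_toSet.mpr ⟨hw, h⟩)
      exact ⟨B, by simp [leafCells, hB], hwB⟩
    · obtain ⟨B, hB, hwB⟩ := ihr (v ++ [true]) (A := rightCell z (c z v) A)
        (Cell.mem_upper_toSet.mpr ⟨hw, h⟩)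
      exact ⟨B, by simp [leafCells, hB], hwB⟩

theorem pairwise_disjoint_leafCells (c : CoordRule p q n) (z : Fin n → Obs p q) (T : BinTree)
    (v : List Bool) (A : Cell p q) :
    (leafCells c z T v A).Pairwise fun B C => Disjoint B.toSet C.toSet := by
  induction T generalizing v A with
  | leaf => simp [leafCells]
  | node l r ihl ihr =>
    rw [leafCells, List.pairwise_append]
    refine ⟨ihl _ _, ihr _ _, fun B hB C hC => ?_⟩
    rw [Set.disjoint_left]
    intro w hwB hwC
    have h1 := (Cell.mem_lower_toSet.mp (subset_of_mem_leafCells hB hwB)).2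
    have h2 := (Cell.mem_upper_toSet.mp (subset_of_mem_leafCells hC hwC)).2
    exact absurd h1 (not_le.mpr h2)

theorem pairwise_disjoint_treePartition (c : CoordRule p q n) (z : Fin n → Obs p q)
    (T : BinTree) :
    Pairwise (Function.onFun Disjoint fun j : Fin (treePartition c z T).length =>
      ((treePartition c z T)[j.1]).toSet) := by
  intro i j hij
  have h := List.pairwise_iff_getElem.mp (pairwise_disjoint_leafCells c z T [] (Cell.root p q))
  rcases lt_or_gt_of_ne hij with hlt | hlt
  · exact h i j i.2 j.2 hlt
  · exact (h j i j.2 i.2 hlt).symm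

theorem existsUnique_mem_treePartition (c : CoordRule p q n) (z : Fin n → Obs p q) (T : BinTree)
    (w : Obs p q) :
    ∃! j : Fin (treePartition c z T).length, w ∈ ((treePartition c z T)[j.1]).toSet := by
  obtain ⟨B, hB, hw⟩ := exists_mem_leafCells c z T [] (A := Cell.root p q) (w := w)
    (by simp [Cell.root, Cell.toSet])
  obtain ⟨j, hj, e⟩ := List.getElem_of_mem hB
  refine ⟨⟨j, hj⟩, ?_, fun i hi => ?_⟩
  · change w ∈ ((leafCells c z T [] (Cell.root p q))[j]).toSet
    rwa [e]
  · by_contra hne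
    refine Set.disjoint_left.mp (pairwise_disjoint_treePartition c z T hne) hi ?_
    change w ∈ ((leafCells c z T [] (Cell.root p q))[j]).toSet
    rwa [e]

/-- A split node contains sample points, so its threshold is a sample coordinate and both children
are again boxes, whichever coordinate the rule selects. -/
theorem exists_boxCell_of_mem_leafCells {c : CoordRule p q n} {z : Fin n → Obs p q} {b : ℝ}
    {T : BinTree} {v : List Bool} {A B : Cell p q} (hT : T.Prunes (growTree c z b v A))
    (hA : ∃ κ, A = boxCell z κ) (hB : B ∈ leafCells c z T v A) : ∃ κ, B = boxCell z κ := by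
  induction T generalizing v A with
  | leaf => rw [leafCells, List.mem_singleton] at hB; rw [hB]; exact hA
  | node l r ihl ihr =>
    rw [growTree] at hT
    split_ifs at hT with hs
    · obtain ⟨κ, rfl⟩ := hA
      obtain ⟨i, hi⟩ := exists_cellMedian_eq (c z v)
        (hs.1.1.mono fun i hi => mem_pointsIn.mpr
          (toSet_leftCell_subset _ _ _ (mem_pointsIn.mp hi)))
      rw [leafCells, List.mem_append] at hB
      rcases hB with hB | hB
      · refine ihl hT.1 ?_ hB
        rw [leftCell, hi]
        exact exists_lower_boxCell z κ _ i
      · refine ihr hT.2 ?_ hB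
        rw [rightCell, hi]
        exact exists_upper_boxCell z κ _ i
    · exact hT.elim

/-- The growing rule guarantees mass `b` to children only. The starting cell needs it separately,
and only when it is itself the leaf. -/
theorem le_empP_of_mem_leafCells {c : CoordRule p q n} {z : Fin n → Obs p q} {b : ℝ}
    {T : BinTree} {v : List Bool} {A B : Cell p q} (hT : T.Prunes (growTree c z b v A))
    (hA : T = BinTree.leaf → b ≤ empP z A) (hB : B ∈ leafCells c z T v A) : b ≤ empP z B := by
  induction T generalizing v A with
  | leaf => rw [leafCells, List.mem_singleton] at hB; rw [hB]; exact hA rfl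
  | node l r ihl ihr =>
    rw [growTree] at hT
    split_ifs at hT with hs
    · rw [leafCells, List.mem_append] at hB
      rcases hB with hB | hB
      · exact ihl hT.1 (fun _ => hs.1.2) hB
      · exact ihr hT.2 (fun _ => hs.2.2) hB
    · exact hT.elim

theorem BinTree.size_pos (T : BinTree) : 0 < T.size := by
  induction T with
  | leaf => simp [BinTree.size]
  | node l r ihl _ => simp only [BinTree.size]; omega

theorem BinTree.two_le_size {T : BinTree} (h : T ≠ BinTree.leaf) : 2 ≤ T.size := by
  cases T with
  | leaf => exact absurd rfl h
  | node l r =>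
    have := l.size_pos
    have := r.size_pos
    simp only [BinTree.size]; omega

end LeafCells

/-! ### Empirical information as an empirical divergence -/

section TreeDivergence

variable {p q n : ℕ}

theorem sum_empP_treePartition (hn : n ≠ 0) (c : CoordRule p q n) (z : Fin n → Obs p q)
    (T : BinTree) :
    ∑ j : Fin (treePartition c z T).length, empP z ((treePartition c z T)[j.1]) = 1 := by
  have h := empProb_biUnion z Finset.univ _ (pairwise_disjoint_treePartition c z T)
  unfold empP
  rw [← h, ← empProb_univ hn z]
  congr 1
  refine Set.eq_univ_of_forall fun w => ?_
  obtain ⟨j, hj, -⟩ := existsUnique_mem_treePartition c z T w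
  simp only [Finset.mem_univ, Set.iUnion_true, Set.mem_iUnion]
  exact ⟨j, hj⟩

theorem partitionDiv_eq_sum (π : List (Cell p q)) (f g : Cell p q → ℝ) :
    partitionDiv π f g = ∑ j : Fin π.length, f π[j.1] * Real.log (f π[j.1] / g π[j.1]) := by
  rw [partitionDiv, ← Fin.sum_univ_fun_getElem]

theorem quantize_eq {c : CoordRule p q n} {z : Fin n → Obs p q} {T : BinTree} {w : Obs p q}
    {j : Fin (treePartition c z T).length} (hj : w ∈ ((treePartition c z T)[j.1]).toSet) :
    quantize (treePartition c z T) w = j + 1 := by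
  classical
  unfold quantize
  rw [Finset.sum_eq_single j]
  · exact if_pos hj
  · intro i _ hij
    refine if_neg fun hi => hij ?_
    exact (existsUnique_mem_treePartition c z T w).unique hi hj
  · simp

/-- Grouping the sample by cell, a cell `A` contributes its logarithm `n * P̂(A)` times. Cells
without points contribute zero on both sides. -/
theorem empInfo_treePartition (c : CoordRule p q n) (z : Fin n → Obs p q) (T : BinTree) :
    empInfo z (treePartition c z T) = empDiv z (treePartition c z T) := by
  classical
  set π := treePartition c z T
  choose J hJ using fun i : Fin n => (existsUnique_mem_treePartition c z T (z i)).exists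
  have hcell : ∀ i, cellNumber π (quantize π (z i)) = π[(J i).1] := by
    intro i
    rw [quantize_eq (hJ i), cellNumber, Nat.add_sub_cancel, List.getD_eq_getElem]
  have hP : ∀ i, 0 < empP z π[(J i).1] := fun i => empProb_pos (hJ i)
  have hQ : ∀ i, 0 < empQ z π[(J i).1] := fun i =>
    mul_pos ((hP i).trans_le (empP_le_fst z _)) ((hP i).trans_le (empP_le_snd z _))
  rw [empInfo, empDiv, partitionDiv_eq_sum]
  simp only [hcell]
  rw [← Finset.prod_div_distrib, Real.log_prod fun i _ => (div_pos (hP i) (hQ i)).ne',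
    ← Finset.sum_fiberwise_of_maps_to (g := J) (t := Finset.univ) (fun _ _ => Finset.mem_univ _),
    Finset.mul_sum]
  refine Finset.sum_congr rfl fun j _ => ?_
  rw [Finset.sum_congr rfl (g := fun _ => Real.log (empP z π[j.1] / empQ z π[j.1]))
    (fun i hi => by obtain rfl := (Finset.mem_filter.mp hi).2; rfl), Finset.sum_const, nsmul_eq_mul]
  have : Finset.univ.filter (fun i => J i = j) = pointsIn z (π[j.1]).toSet := by
    ext i
    rw [mem_pointsIn, Finset.mem_filter]
    constructor
    · rintro ⟨-, rfl⟩; exact hJ i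
    · intro h
      exact ⟨Finset.mem_univ _, (existsUnique_mem_treePartition c z T (z i)).unique (hJ i) h⟩
  rw [this, empP, empProb]
  ring

end TreeDivergence

/-! ### From uniform deviations of box unions to divergences -/

section UniformDeviation

variable {p q n : ℕ}

/-- The empirical and the true probability of every union of `k` boxes with end points in the
sample differ by at most `t`. -/
def BoxUnionDeviation (P : Measure (Obs p q)) (z : Fin n → Obs p q) (k : ℕ) (t : ℝ) : Prop :=
  ∀ f : Fin k → BoxCode p q n,
    |empProb z (⋃ m, (boxCell z (f m)).toSet) - P.real (⋃ m, (boxCell z (f m)).toSet)| ≤ t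

theorem measurableSet_sampleInterval (z : Fin n → Obs p q) (j : Fin p ⊕ Fin q)
    (o : Option (Fin n) × Option (Fin n)) : MeasurableSet (sampleInterval z j o) := by
  obtain ⟨_ | i, _ | i'⟩ := o
  · rw [sampleInterval_none]; exact MeasurableSet.univ
  · exact MeasurableSet.congr (measurableSet_Iic (a := coordVal j (z i'))) (by
      ext; simp [sampleInterval])
  · exact MeasurableSet.congr (measurableSet_Ioi (a := coordVal j (z i))) (by
      ext; simp [sampleInterval])
  · exact MeasurableSet.congr
      (measurableSet_Ioc (a := coordVal j (z i)) (b := coordVal j (z i'))) (by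
        ext; simp [sampleInterval])

theorem measurableSet_boxCell_fst (z : Fin n → Obs p q) (κ : BoxCode p q n) :
    MeasurableSet (boxCell z κ).fst :=
  MeasurableSet.congr
    (MeasurableSet.univ_pi fun i => measurableSet_sampleInterval z (Sum.inl i) (κ (Sum.inl i)))
    (by ext; simp [boxCell])

theorem measurableSet_boxCell_snd (z : Fin n → Obs p q) (κ : BoxCode p q n) :
    MeasurableSet (boxCell z κ).snd :=
  MeasurableSet.congr
    (MeasurableSet.univ_pi fun i => measurableSet_sampleInterval z (Sum.inr i) (κ (Sum.inr i)))
    (by ext; simp [boxCell])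

theorem measurableSet_boxCell (z : Fin n → Obs p q) (κ : BoxCode p q n) :
    MeasurableSet (boxCell z κ).toSet :=
  (measurableSet_boxCell_fst z κ).prod (measurableSet_boxCell_snd z κ)

theorem prodMarginals_real_boxCell (P : Measure (Obs p q)) [IsProbabilityMeasure P]
    (z : Fin n → Obs p q) (κ : BoxCode p q n) :
    (prodMarginals P).real (boxCell z κ).toSet
      = P.real ((boxCell z κ).fst ×ˢ Set.univ) * P.real (Set.univ ×ˢ (boxCell z κ).snd) := by
  have : IsProbabilityMeasure (P.map Prod.fst) := Measure.isProbabilityMeasure_map (by fun_prop)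
  have : IsProbabilityMeasure (P.map Prod.snd) := Measure.isProbabilityMeasure_map (by fun_prop)
  rw [prodMarginals, Cell.toSet, measureReal_prod_prod,
    map_measureReal_apply measurable_fst (measurableSet_boxCell_fst z κ),
    map_measureReal_apply measurable_snd (measurableSet_boxCell_snd z κ), Set.prod_univ,
    Set.univ_prod]

theorem BoxUnionDeviation.single {P : Measure (Obs p q)} {z : Fin n → Obs p q} {k : ℕ} {t : ℝ}
    (h : BoxUnionDeviation P z k t) (hk : 0 < k) (κ : BoxCode p q n) :
    |empProb z (boxCell z κ).toSet - P.real (boxCell z κ).toSet| ≤ t := by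
  have : Nonempty (Fin k) := ⟨⟨0, hk⟩⟩
  simpa [Set.iUnion_const] using h fun _ => κ

open Classical in
theorem BoxUnionDeviation.finset {P : Measure (Obs p q)} {z : Fin n → Obs p q} {k : ℕ} {t : ℝ}
    (h : BoxUnionDeviation P z k t) (ht : 0 ≤ t) (f : Fin k → BoxCode p q n)
    (J : Finset (Fin k)) :
    |empProb z (⋃ j ∈ J, (boxCell z (f j)).toSet) - P.real (⋃ j ∈ J, (boxCell z (f j)).toSet)|
      ≤ t := by
  rcases J.eq_empty_or_nonempty with rfl | ⟨j₀, hj₀⟩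
  · simpa [empProb, pointsIn] using ht
  · have e : (⋃ j ∈ J, (boxCell z (f j)).toSet)
        -- Repeating one box of `J` pads the union to exactly `k` boxes.
        = ⋃ m, (boxCell z (f (if m ∈ J then m else j₀))).toSet := by
      ext w
      simp only [Set.mem_iUnion]
      constructor
      · rintro ⟨j, hj, hw⟩
        exact ⟨j, by rwa [if_pos hj]⟩
      · rintro ⟨m, hw⟩
        split_ifs at hw with hm
        · exact ⟨m, hm, hw⟩
        · exact ⟨j₀, hj₀, hw⟩
    rw [e]
    exact h fun m => f (if m ∈ J then m else j₀)

/-- The leaf cells are disjoint with total mass one, and each has mass at least `b`. -/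
theorem size_mul_le_one (hn : n ≠ 0) {c : CoordRule p q n} {z : Fin n → Obs p q} {b : ℝ}
    {T : BinTree} (hT : T.Prunes (fullTree c z b)) (hT' : T ≠ BinTree.leaf) :
    T.size * b ≤ 1 := by
  rw [← sum_empP_treePartition hn c z T, ← length_treePartition c z T]
  have h : ∑ _j : Fin (treePartition c z T).length, b
      ≤ ∑ j : Fin (treePartition c z T).length, empP z ((treePartition c z T)[j.1]) :=
    Finset.sum_le_sum fun j _ => le_empP_of_mem_leafCells hT (fun e => absurd e hT')
      (List.getElem_mem j.2)
  simpa using h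

/-- The strips `A¹ × ℝ^q` and `ℝ^p × A²` are boxes too, with the constraints of the other block
erased, so the same event controls the marginals. -/
theorem partition_divergence_deviation {z : Fin n → Obs p q} {b t : ℝ} (hb : 0 < b)
    (hb1 : b ≤ 1) (ht : 0 ≤ t) (P : Measure (Obs p q)) [IsProbabilityMeasure P]
    {π : List (Cell p q)} (hsize : 0 < π.length) (hk : π.length * b ≤ 1)
    (hle : ∀ j : Fin π.length, b ≤ empP z π[j.1])
    (hbox : ∀ j : Fin π.length, ∃ κ, π[j.1] = boxCell z κ)
    (hdisj : Pairwise (Function.onFun Disjoint fun j : Fin π.length => (π[j.1]).toSet))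
    (hdev : BoxUnionDeviation P z π.length t) :
    trueDiv P π - empDiv z π ≤ 5 * t / b ∧
      (P = prodMarginals P → empDiv z π ≤ 4 * t / b) := by
  rw [trueDiv, empDiv, partitionDiv_eq_sum, partitionDiv_eq_sum]
  choose κ hκ using hbox
  simp only [hκ] at *
  have hJ : ∀ J : Finset (Fin π.length), |∑ j ∈ J, empP z (boxCell z (κ j))
      - ∑ j ∈ J, P.real (boxCell z (κ j)).toSet| ≤ t := by
    intro J
    have := hdev.finset ht κ J
    rwa [empProb_biUnion z J _ hdisj, measureReal_biUnion_finset (fun i _ j _ hij => hdisj hij)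
      (fun j _ => measurableSet_boxCell z (κ j))] at this
  have h1 : ∀ j, |empProb z ((boxCell z (κ j)).fst ×ˢ Set.univ)
      - P.real ((boxCell z (κ j)).fst ×ˢ Set.univ)| ≤ t := fun j => by
    rw [boxCell_fst_prod_univ]; exact hdev.single hsize _
  have h2 : ∀ j, |empProb z (Set.univ ×ˢ (boxCell z (κ j)).snd)
      - P.real (Set.univ ×ˢ (boxCell z (κ j)).snd)| ≤ t := fun j => by
    rw [boxCell_univ_prod_snd]; exact hdev.single hsize _
  constructor
  · simp only [prodMarginals_real_boxCell]
    exact sum_mul_log_sub_le hb ht (by simpa using hk) hle (fun _ => empP_le_fst z _)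
      (fun _ => empP_le_snd z _) (fun _ => empProb_le_one z _) (fun _ => empProb_le_one z _)
      (fun _ => measureReal_nonneg)
      (fun _ => measureReal_mono (Set.prod_mono_right (Set.subset_univ _)))
      (fun _ => measureReal_mono (Set.prod_mono_left (Set.subset_univ _)))
      (fun _ => measureReal_le_one) hJ h1 h2
  · intro hP
    refine sum_mul_log_le_of_eq_mul hb hb1 ht (by simpa using hk) hle (fun _ => empP_le_fst z _)
      (fun _ => empP_le_snd z _) (fun _ => empProb_le_one z _) (fun _ => empProb_le_one z _)
      (fun _ => measureReal_nonneg) (fun _ => measureReal_nonneg)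
      (u := fun j => P.real (boxCell z (κ j)).toSet) (fun j => ?_) hJ h1 h2
    rw [← prodMarginals_real_boxCell, ← hP]

theorem divergence_deviation (hn : n ≠ 0) {c : CoordRule p q n} {z : Fin n → Obs p q} {b t : ℝ}
    (hb : 0 < b) (ht : 0 ≤ t) {T : BinTree} (hT : T.Prunes (fullTree c z b))
    (hT' : T ≠ BinTree.leaf) (P : Measure (Obs p q)) [IsProbabilityMeasure P]
    (hdev : BoxUnionDeviation P z T.size t) :
    trueDiv P (treePartition c z T) - empDiv z (treePartition c z T) ≤ 5 * t / b ∧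
      (P = prodMarginals P → empDiv z (treePartition c z T) ≤ 4 * t / b) := by
  have hk := size_mul_le_one hn hT hT'
  have hsize := T.size_pos
  have hk1 : (1 : ℝ) ≤ T.size := by exact_mod_cast hsize
  have hb1 : b ≤ 1 := by nlinarith
  rw [← length_treePartition c z T] at hk hdev hsize
  exact partition_divergence_deviation hb hb1 ht P hsize hk
    (fun j => le_empP_of_mem_leafCells hT (fun e => absurd e hT') (List.getElem_mem j.2))
    (fun j => exists_boxCell_of_mem_leafCells hT ⟨_, root_eq_boxCell z⟩ (List.getElem_mem j.2))
    (pairwise_disjoint_treePartition c z T) hdev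

end UniformDeviation

/-! ### Hoeffding's inequality for sets that depend on few sample points -/

section Concentration

variable {E : Type*} [MeasurableSpace E]

/-- A variable with range of length one is sub-Gaussian with parameter `1 / 4`. The free left end
`a` serves an indicator and its negative alike, and `N` allows the bound to be stated with the full
sample size when only part of the sample is summed. -/
theorem pi_measure_sum_ge_le {ι : Type*} [Fintype ι] (P : Measure E) [IsProbabilityMeasure P]
    {g : E → ℝ} (hg : Measurable g) {a : ℝ} (hga : ∀ x, g x ∈ Set.Icc a (a + 1))
    {θ N : ℝ} (hθ : 0 < θ) (hN : Fintype.card ι ≤ N) :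
    (Measure.pi fun _ : ι => P) {y | θ ≤ ∑ i, (g (y i) - ∫ x, g x ∂P)}
      ≤ ENNReal.ofReal (Real.exp (-(2 * θ ^ 2 / N))) := by
  rcases isEmpty_or_nonempty ι with hι | hι
  · simp [not_le.mpr hθ]
  have hind : iIndepFun (fun (i : ι) (y : ι → E) => g (y i) - ∫ x, g x ∂P)
      (Measure.pi fun _ : ι => P) :=
    iIndepFun_pi (X := fun _ x => g x - ∫ x, g x ∂P) fun _ => (hg.sub_const _).aemeasurable
  have hsub : ∀ i : ι, HasSubgaussianMGF (fun y : ι → E => g (y i) - ∫ x, g x ∂P) (1 / 4)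
      (Measure.pi fun _ : ι => P) := by
    intro i
    have h := hasSubgaussianMGF_of_mem_Icc (μ := Measure.pi fun _ : ι => P)
      (X := fun y => g (y i)) (a := a) (b := a + 1)
      (hg.comp (measurable_pi_apply i)).aemeasurable (ae_of_all _ fun y => hga (y i))
    have he : ∫ y : ι → E, g (y i) ∂(Measure.pi fun _ : ι => P) = ∫ x, g x ∂P := by
      have hmp := measurePreserving_eval (fun _ : ι => P) i
      conv_rhs => rw [← hmp.map_eq]
      rw [integral_map hmp.measurable.aemeasurable (by rw [hmp.map_eq]; exact hg.aestronglyMeasurable)]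
    rw [he] at h
    convert h using 1
    rw [add_sub_cancel_left, nnnorm_one]
    norm_num
  have h := HasSubgaussianMGF.measure_sum_ge_le_of_iIndepFun hind (s := Finset.univ)
    (fun i _ => hsub i) hθ.le
  rw [measureReal_def] at h
  refine (ENNReal.le_ofReal_iff_toReal_le (measure_ne_top _ _) (Real.exp_pos _).le).mpr ?_
  refine h.trans (Real.exp_le_exp.mpr ?_)
  have hc : (0 : ℝ) < Fintype.card ι := by exact_mod_cast Fintype.card_pos
  rw [neg_div, neg_le_neg_iff]
  push_cast
  rw [Finset.sum_const, Finset.card_univ, nsmul_eq_mul,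
    show θ ^ 2 / (2 * (Fintype.card ι * (1 / 4 : ℝ))) = 2 * θ ^ 2 / Fintype.card ι by
      field_simp; ring]
  gcongr

theorem pi_measure_abs_sum_gt_le {ι : Type*} [Fintype ι] (P : Measure E) [IsProbabilityMeasure P]
    {V : Set E} (hV : MeasurableSet V) {θ N : ℝ} (hθ : 0 < θ) (hN : Fintype.card ι ≤ N) :
    (Measure.pi fun _ : ι => P)
        {y | θ < |∑ i, (V.indicator (fun _ => (1 : ℝ)) (y i) - P.real V)|}
      ≤ ENNReal.ofReal (2 * Real.exp (-(2 * θ ^ 2 / N))) := by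
  have hm : Measurable (V.indicator fun _ => (1 : ℝ)) := measurable_const.indicator hV
  have hint : ∫ x, V.indicator (fun _ => (1 : ℝ)) x ∂P = P.real V := integral_indicator_one hV
  have h1 := pi_measure_sum_ge_le (ι := ι) P hm (a := 0)
    (fun x => by by_cases h : x ∈ V <;> simp [h]) hθ hN
  have h2 := pi_measure_sum_ge_le (ι := ι) P hm.neg (a := -1)
    (fun x => by by_cases h : x ∈ V <;> simp [h]) hθ hN
  simp only [Pi.neg_apply, integral_neg, hint] at h1 h2
  rw [two_mul, ENNReal.ofReal_add (Real.exp_pos _).le (Real.exp_pos _).le]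
  refine le_trans (measure_mono ?_) ((measure_union_le _ _).trans (add_le_add h1 h2))
  intro y hy
  rcases lt_abs.mp (Set.mem_ofPred_eq ▸ hy : θ < |_|) with h | h
  · exact Or.inl h.le
  · refine Or.inr ?_
    rw [← Finset.sum_neg_distrib] at h
    refine h.le.trans_eq (Finset.sum_congr rfl fun i _ => by ring)

theorem measurable_indicator_section {n : ℕ} {U : (Fin n → E) → Set E}
    (hU : MeasurableSet {r : (Fin n → E) × E | r.2 ∈ U r.1}) (i : Fin n) :
    Measurable fun z : Fin n → E => (U z).indicator (fun _ => (1 : ℝ)) (z i) := by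
  have : Measurable fun z : Fin n → E => (z, z i) :=
    measurable_id.prodMk (measurable_pi_apply _)
  exact ((measurable_const (a := (1 : ℝ))).indicator hU).comp this

theorem measurable_measureReal_section {n : ℕ} (P : Measure E) [IsProbabilityMeasure P]
    {U : (Fin n → E) → Set E} (hU : MeasurableSet {r : (Fin n → E) × E | r.2 ∈ U r.1}) :
    Measurable fun z : Fin n → E => P.real (U z) :=
  (measurable_measure_prodMk_left hU).ennreal_toReal

open Classical in
/-- A set that depends on the sample points with indices in `S` only satisfies Hoeffding's
inequality up to the number of those points. -/
theorem pi_measure_abs_sum_dependent_gt_le {n : ℕ} (P : Measure E) [IsProbabilityMeasure P]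
    (S : Finset (Fin n)) (U : (Fin n → E) → Set E)
    (hU : MeasurableSet {r : (Fin n → E) × E | r.2 ∈ U r.1})
    (hdep : ∀ z z', (∀ i ∈ S, z i = z' i) → U z = U z') {s θ : ℝ} (hs : S.card ≤ s)
    (hθ : 0 < θ) :
    (Measure.pi fun _ : Fin n => P)
        {z | s + θ < |∑ i, ((U z).indicator (fun _ => (1 : ℝ)) (z i) - P.real (U z))|}
      ≤ ENNReal.ofReal (2 * Real.exp (-(2 * θ ^ 2 / n))) := by
  set D : Set (Fin n → E) :=
    {z | θ < |∑ i : {i // i ∉ S}, ((U z).indicator (fun _ => (1 : ℝ)) (z i) - P.real (U z))|}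
    with hD
  have hUz : ∀ z, MeasurableSet (U z) := fun z => measurable_prodMk_left hU
  have hDm : MeasurableSet D := by
    refine measurableSet_lt measurable_const (Measurable.abs ?_)
    exact Finset.measurable_sum _ fun i _ => (measurable_indicator_section hU i).sub
      (measurable_measureReal_section P hU)
  have hsub : {z : Fin n → E |
      s + θ < |∑ i, ((U z).indicator (fun _ => (1 : ℝ)) (z i) - P.real (U z))|} ⊆ D := by
    intro z hz
    have hz' : s + θ < |∑ i, ((U z).indicator (fun _ => (1 : ℝ)) (z i) - P.real (U z))| := hz
    have hterm : ∀ i, |(U z).indicator (fun _ => (1 : ℝ)) (z i) - P.real (U z)| ≤ 1 := by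
      intro i
      have h0 : 0 ≤ P.real (U z) := measureReal_nonneg
      have h1 : P.real (U z) ≤ 1 := measureReal_le_one
      by_cases h : z i ∈ U z <;> simp only [h, Set.indicator_of_mem, Set.indicator_of_notMem,
        not_false_eq_true] <;> rw [abs_le] <;> constructor <;> linarith
    -- The points that determine the set are not independent of it; each is charged its maximal
    -- contribution one.
    have hS : |∑ i ∈ S, ((U z).indicator (fun _ => (1 : ℝ)) (z i) - P.real (U z))| ≤ s :=
      calc _ ≤ ∑ i ∈ S, |(U z).indicator (fun _ => (1 : ℝ)) (z i) - P.real (U z)| :=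
            Finset.abs_sum_le_sum_abs _ _
        _ ≤ ∑ _i ∈ S, (1 : ℝ) := Finset.sum_le_sum fun i _ => hterm i
        _ ≤ s := by simpa using hs
    rw [← Finset.sum_add_sum_compl S] at hz'
    have hc : ∑ i ∈ Sᶜ, ((U z).indicator (fun _ => (1 : ℝ)) (z i) - P.real (U z))
        = ∑ i : {i // i ∉ S}, ((U z).indicator (fun _ => (1 : ℝ)) (z i) - P.real (U z)) :=
      Finset.sum_subtype Sᶜ (by simp) _
    rw [hc] at hz'
    have := abs_add_le (∑ i ∈ S, ((U z).indicator (fun _ => (1 : ℝ)) (z i) - P.real (U z)))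
      (∑ i : {i // i ∉ S}, ((U z).indicator (fun _ => (1 : ℝ)) (z i) - P.real (U z)))
    change θ < _
    linarith
  refine (measure_mono hsub).trans ?_
  -- By Fubini it suffices to bound each section with the coordinates in `S` fixed; there the set is
  -- constant and the other points are still i.i.d.
  have hmp := (measurePreserving_piEquivPiSubtypeProd (fun _ : Fin n => P) (fun i => i ∈ S)).symm
  rw [← hmp.measure_preimage hDm.nullMeasurableSet,
    Measure.prod_apply (hmp.measurable hDm)]
  refine (lintegral_mono (g := fun _ => ENNReal.ofReal (2 * Real.exp (-(2 * θ ^ 2 / n))))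
    fun x => ?_).trans (by simp)
  set e := MeasurableEquiv.piEquivPiSubtypeProd (fun _ : Fin n => E) (fun i => i ∈ S)
  rcases Set.eq_empty_or_nonempty (Prod.mk x ⁻¹' (e.symm ⁻¹' D)) with h | ⟨y₀, -⟩
  · rw [h, measure_empty]; exact zero_le
  have hV : ∀ y, U (e.symm (x, y)) = U (e.symm (x, y₀)) := fun y => hdep _ _ fun i hi => by
    simp [e, MeasurableEquiv.piEquivPiSubtypeProd, hi]
  have hy : ∀ y (i : {i // i ∉ S}), e.symm (x, y) i = y i := fun y i => by
    simp [e, MeasurableEquiv.piEquivPiSubtypeProd, i.2]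
  refine le_trans (le_of_eq ?_)
    (pi_measure_abs_sum_gt_le (ι := {i // i ∉ S}) P (hUz (e.symm (x, y₀))) hθ (N := n) ?_)
  · congr 1
    ext y
    simp only [hD, Set.mem_preimage, Set.mem_ofPred_eq, hV y, hy]
  · have := Fintype.card_subtype_le (fun i : Fin n => i ∉ S)
    rw [Fintype.card_fin] at this
    exact_mod_cast this

end Concentration

/-! ### Union bound over box codes and numbers of cells -/

section BoxUnions

variable {p q n : ℕ}

/-- The indices of the sample points that occur in a family of box codes. -/
def codeSupport {k : ℕ} (f : Fin k → BoxCode p q n) : Finset (Fin n) :=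
  Finset.univ.biUnion fun r : Fin k × (Fin p ⊕ Fin q) =>
    (f r.1 r.2).1.toFinset ∪ (f r.1 r.2).2.toFinset

theorem card_codeSupport_le {k : ℕ} (f : Fin k → BoxCode p q n) :
    (codeSupport f).card ≤ k * (p + q) * 2 := by
  have hcard : ∀ o : Option (Fin n), o.toFinset.card ≤ 1 := by
    rintro (_ | i) <;> simp
  have h := Finset.card_biUnion_le_card_mul (Finset.univ : Finset (Fin k × (Fin p ⊕ Fin q)))
    (fun r => (f r.1 r.2).1.toFinset ∪ (f r.1 r.2).2.toFinset) 2 fun r _ =>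
      (Finset.card_union_le _ _).trans (Nat.add_le_add (hcard _) (hcard _))
  simpa [codeSupport] using h

theorem boxCell_congr {k : ℕ} (f : Fin k → BoxCode p q n) {z z' : Fin n → Obs p q}
    (h : ∀ i ∈ codeSupport f, z i = z' i) (m : Fin k) :
    (boxCell z (f m)).toSet = (boxCell z' (f m)).toSet := by
  ext w
  rw [mem_boxCell_toSet, mem_boxCell_toSet]
  refine forall_congr' fun j => ?_
  have h1 : ∀ i ∈ (f m j).1, z i = z' i := fun i hi => h i
    (Finset.mem_biUnion.mpr ⟨(m, j), Finset.mem_univ _, by simp_all⟩)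
  have h2 : ∀ i ∈ (f m j).2, z i = z' i := fun i hi => h i
    (Finset.mem_biUnion.mpr ⟨(m, j), Finset.mem_univ _, by simp_all⟩)
  refine and_congr (forall₂_congr fun i hi => ?_) (forall₂_congr fun i hi => ?_)
  · rw [h1 i hi]
  · rw [h2 i hi]

theorem measurable_coordVal (j : Fin p ⊕ Fin q) :
    Measurable fun w : Obs p q => coordVal j w := by
  cases j <;> simp only [coordVal, Sum.elim_inl, Sum.elim_inr] <;> fun_prop

theorem measurableSet_mem_iUnion_boxCell {k : ℕ} (f : Fin k → BoxCode p q n) :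
    MeasurableSet {r : (Fin n → Obs p q) × Obs p q | r.2 ∈ ⋃ m, (boxCell r.1 (f m)).toSet} := by
  have hc : ∀ j i, Measurable fun r : (Fin n → Obs p q) × Obs p q => coordVal j (r.1 i) :=
    fun j i => (measurable_coordVal j).comp ((measurable_pi_apply i).comp measurable_fst)
  have hw : ∀ j, Measurable fun r : (Fin n → Obs p q) × Obs p q => coordVal j r.2 :=
    fun j => (measurable_coordVal j).comp measurable_snd
  simp only [Set.mem_iUnion, mem_boxCell_toSet]
  refine MeasurableSet.congr (MeasurableSet.iUnion fun m => MeasurableSet.iInter fun j =>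
    (MeasurableSet.iInter fun i => MeasurableSet.iInter fun _ : i ∈ (f m j).1 =>
      measurableSet_lt (hc j i) (hw j)).inter
    (MeasurableSet.iInter fun i => MeasurableSet.iInter fun _ : i ∈ (f m j).2 =>
      measurableSet_le (hw j) (hc j i))) ?_
  ext r
  simp [sampleInterval]

theorem measure_boxUnion_deviation_le (P : Measure (Obs p q)) [IsProbabilityMeasure P] {k : ℕ}
    (f : Fin k → BoxCode p q n) {X : ℝ} (hn : 0 < n) (hX : 0 < X) (hkX : k * (p + q : ℕ) ≤ X) :
    (Measure.pi fun _ : Fin n => P)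
        {z | 4 * √2 * √(X / n) < |empProb z (⋃ m, (boxCell z (f m)).toSet)
          - P.real (⋃ m, (boxCell z (f m)).toSet)|}
      ≤ ENNReal.ofReal (2 * Real.exp (-(32 * X))) := by
  have hn' : (0 : ℝ) < n := by exact_mod_cast hn
  set r := √(X / n) with hr
  have hr0 : 0 < r := Real.sqrt_pos.mpr (by positivity)
  have hr2 : n * r ^ 2 = X := by
    rw [hr, Real.sq_sqrt (by positivity)]; field_simp
  have hs2 : (1.4 : ℝ) ≤ √2 := by
    refine Real.le_sqrt_of_sq_le ?_; norm_num
  -- A threshold of at least one is never exceeded. Otherwise `r` is so small that the charge `2 * X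
  -- = 2 * n * r ^ 2` for the dependent points fits into the gap between `4 * n * r` and `4 * √2 * n
  -- * r`.
  rcases le_or_gt 1 (4 * √2 * r) with h1 | h1
  · refine le_trans (le_of_eq ?_) zero_le
    convert measure_empty (μ := Measure.pi fun _ : Fin n => P)
    refine Set.eq_empty_of_forall_notMem fun z hz => ?_
    refine absurd (h1.trans_lt hz) (not_lt.mpr ?_)
    have := empProb_nonneg z (⋃ m, (boxCell z (f m)).toSet)
    have := empProb_le_one z (⋃ m, (boxCell z (f m)).toSet)
    have : 0 ≤ P.real (⋃ m, (boxCell z (f m)).toSet) := measureReal_nonneg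
    have : P.real (⋃ m, (boxCell z (f m)).toSet) ≤ 1 := measureReal_le_one
    rw [abs_le]
    constructor <;> linarith
  · have hs : ((codeSupport f).card : ℝ) ≤ 2 * X := by
      have : ((codeSupport f).card : ℝ) ≤ k * (p + q : ℕ) * 2 := by
        exact_mod_cast card_codeSupport_le f
      linarith
    have h := pi_measure_abs_sum_dependent_gt_le P (codeSupport f)
      (fun z => ⋃ m, (boxCell z (f m)).toSet) (measurableSet_mem_iUnion_boxCell f)
      (fun z z' hz => Set.iUnion_congr fun m => boxCell_congr f hz m) hs
      (θ := 4 * (n * r)) (by positivity)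
    have he : 2 * (4 * (n * r)) ^ 2 / (n : ℝ) = 32 * X := by
      rw [← hr2]; field_simp; ring
    rw [he] at h
    refine (measure_mono fun z hz => ?_).trans h
    have hz' : 4 * √2 * r < |empProb z (⋃ m, (boxCell z (f m)).toSet)
          - P.real (⋃ m, (boxCell z (f m)).toSet)| := hz
    have hsum : ∑ i, ((⋃ m, (boxCell z (f m)).toSet).indicator (fun _ => (1 : ℝ)) (z i)
          - P.real (⋃ m, (boxCell z (f m)).toSet))
        = n * (empProb z (⋃ m, (boxCell z (f m)).toSet)
          - P.real (⋃ m, (boxCell z (f m)).toSet)) := by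
      rw [empProb_eq_sum, Finset.sum_sub_distrib, Finset.sum_const, Finset.card_univ,
        Fintype.card_fin, nsmul_eq_mul]
      field_simp
    change 2 * X + 4 * (n * r) < |_|
    rw [hsum, abs_mul, abs_of_pos hn']
    refine lt_of_le_of_lt ?_ (mul_lt_mul_of_pos_left hz' hn')
    rw [← hr2]
    have hr1 : 2 * r ≤ 4 * √2 - 4 := by nlinarith
    nlinarith [mul_le_mul_of_nonneg_left hr1 (mul_pos hn' hr0).le]

/-- Needed to transfer the bound from the product measure to `μ` by `Measure.map_apply`. -/
theorem measurableSet_not_boxUnionDeviation (P : Measure (Obs p q)) [IsProbabilityMeasure P]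
    (k : ℕ) (t : ℝ) : MeasurableSet {z : Fin n → Obs p q | ¬ BoxUnionDeviation P z k t} := by
  have hm : ∀ f : Fin k → BoxCode p q n, Measurable fun z : Fin n → Obs p q =>
      |empProb z (⋃ m, (boxCell z (f m)).toSet) - P.real (⋃ m, (boxCell z (f m)).toSet)| := by
    intro f
    have hU := measurableSet_mem_iUnion_boxCell f
    simp only [empProb_eq_sum]
    exact Measurable.abs ((Measurable.div_const (Finset.measurable_sum _ fun i _ =>
      measurable_indicator_section (U := fun z => ⋃ m, (boxCell z (f m)).toSet) hU i) _).sub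
      (measurable_measureReal_section P (U := fun z => ⋃ m, (boxCell z (f m)).toSet) hU))
  have h := MeasurableSet.iUnion fun f => measurableSet_lt (measurable_const (a := t)) (hm f)
  convert h using 1
  ext z
  simp [BoxUnionDeviation]

theorem measure_not_boxUnionDeviation_le (P : Measure (Obs p q)) [IsProbabilityMeasure P]
    {k : ℕ} (hn : 2 ≤ n) (hk : 0 < k) {b δ : ℝ} (hb : 0 < b) (hb1 : b ≤ 1) (hδ : 0 < δ)
    (hδ1 : δ ≤ 1) :
    (Measure.pi fun _ : Fin n => P)
        {z | ¬ BoxUnionDeviation P z k (b * confWidth n b (p + q) (δ * b) k / 6)}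
      ≤ ENNReal.ofReal (δ * b) := by
  set d := p + q with hd
  set L : ℝ := ((d : ℕ) + 1) * Real.log 2 + (d : ℕ) * Real.log n with hL
  set X : ℝ := Real.log (8 / (δ * b)) + k * L with hXdef
  have hn2 : (2 : ℝ) ≤ n := by exact_mod_cast hn
  have hk1 : (1 : ℝ) ≤ k := by exact_mod_cast hk
  have hlog2 : (0.69 : ℝ) < Real.log 2 := by linarith [Real.log_two_gt_d9]
  have hlogn : Real.log 2 ≤ Real.log n := Real.log_le_log (by norm_num) hn2
  have hd0 : (0 : ℝ) ≤ (d : ℕ) := Nat.cast_nonneg _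
  have hδb : δ * b ≤ 1 := mul_le_one₀ hδ1 hb.le hb1
  have hδb0 : 0 < δ * b := mul_pos hδ hb
  have ha : 0 < Real.log (8 / (δ * b)) := by
    refine Real.log_pos ?_
    rw [lt_div_iff₀ hδb0]; linarith
  -- This uses `n ≥ 2`, through `L ≥ 2 * d * log 2`. It yields `k * d ≤ X`, which bounds the number
  -- of dependent points by `2 * X`.
  have hLd : (d : ℝ) ≤ L := by nlinarith
  have hL0 : 0 ≤ L := hd0.trans hLd
  have hX : 0 < X := by positivity
  have hkX : (k : ℝ) * (d : ℕ) ≤ X := by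
    have := mul_le_mul_of_nonneg_left hLd (by linarith : (0 : ℝ) ≤ k)
    linarith
  have hwidth : b * confWidth n b d (δ * b) k / 6 = 4 * √2 * √(X / n) := by
    rw [confWidth, ← hL, ← hXdef, Real.sqrt_div hX.le]
    field_simp
    ring
  have hsub : {z | ¬ BoxUnionDeviation P z k (b * confWidth n b d (δ * b) k / 6)}
      ⊆ ⋃ f : Fin k → BoxCode p q n, {z | 4 * √2 * √(X / n) <
        |empProb z (⋃ m, (boxCell z (f m)).toSet) - P.real (⋃ m, (boxCell z (f m)).toSet)|} := by
    intro z hz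
    rw [Set.mem_ofPred_eq, hwidth, BoxUnionDeviation] at hz
    push Not at hz
    simpa using hz
  refine (measure_mono hsub).trans ((measure_iUnion_fintype_le _ _).trans ?_)
  refine (Finset.sum_le_sum fun f _ =>
    measure_boxUnion_deviation_le P f (by omega) hX hkX).trans ?_
  rw [Finset.sum_const, nsmul_eq_mul, ← ENNReal.ofReal_natCast,
    ← ENNReal.ofReal_mul (Nat.cast_nonneg _)]
  refine ENNReal.ofReal_le_ofReal ?_
  have hcard : (((Finset.univ : Finset (Fin k → BoxCode p q n)).card : ℕ) : ℝ)
      = ((n : ℝ) + 1) ^ (2 * d * k) := by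
    simp [hd, ← pow_mul, ← sq]
  -- The term `k * L` in the width pays for counting the codes; the term `log (8 / (δ * b))` leaves
  -- the failure probability.
  have hcount : ((n : ℝ) + 1) ^ (2 * d * k) ≤ Real.exp (2 * X) := by
    calc ((n : ℝ) + 1) ^ (2 * d * k) ≤ (2 * (n : ℝ)) ^ (2 * d * k) := by
          gcongr; linarith
      _ = Real.exp ((2 * d * k : ℕ) * (Real.log 2 + Real.log n)) := by
          rw [← Real.log_mul (by norm_num) (by positivity), Real.exp_nat_mul,
            Real.exp_log (by positivity)]
      _ ≤ Real.exp (2 * X) := by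
          refine Real.exp_le_exp.mpr ?_
          push_cast
          have : (d : ℝ) * (Real.log 2 + Real.log n) ≤ L := by rw [hL]; nlinarith
          have := mul_le_mul_of_nonneg_left this (by linarith : (0 : ℝ) ≤ k)
          nlinarith
  have hexp : Real.exp (-Real.log (8 / (δ * b))) = δ * b / 8 := by
    rw [Real.exp_neg, Real.exp_log (by positivity), inv_div]
  have hXa : Real.log (8 / (δ * b)) ≤ X := by rw [hXdef]; nlinarith
  calc (((Finset.univ : Finset (Fin k → BoxCode p q n)).card : ℕ) : ℝ)
        * (2 * Real.exp (-(32 * X)))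
      ≤ Real.exp (2 * X) * (2 * Real.exp (-(32 * X))) := by
        rw [hcard]; gcongr
    _ = 2 * Real.exp (-(30 * X)) := by
        rw [show -(30 * X) = 2 * X + -(32 * X) by ring, Real.exp_add]; ring
    _ ≤ 2 * Real.exp (-Real.log (8 / (δ * b))) := by
        gcongr; linarith
    _ ≤ δ * b := by rw [hexp]; linarith

theorem measure_exists_not_boxUnionDeviation_le (P : Measure (Obs p q)) [IsProbabilityMeasure P]
    {Ω : Type*} [MeasurableSpace Ω] (μ : Measure Ω) [IsProbabilityMeasure μ]
    (Z : ℕ → Ω → Obs p q) (hZ_meas : ∀ i, Measurable (Z i)) (hZ_law : ∀ i, μ.map (Z i) = P)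
    (hZ_indep : iIndepFun Z μ) (hn : 2 ≤ n) {b δ : ℝ} (hb : 0 < b) (hδ : 0 < δ) (hδ1 : δ ≤ 1) :
    μ {ω | ∃ k : ℕ, 2 ≤ k ∧ k * b ≤ 1 ∧ ¬ BoxUnionDeviation P (fun i : Fin n => Z i ω) k
        (b * confWidth n b (p + q) (δ * b) k / 6)} ≤ ENNReal.ofReal δ := by
  have hlaw : μ.map (fun ω (i : Fin n) => Z i ω) = Measure.pi fun _ : Fin n => P := by
    have h := (iIndepFun_iff_map_fun_eq_pi_map (f := fun (i : Fin n) => Z i)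
      fun i => (hZ_meas i).aemeasurable).mp (hZ_indep.precomp Fin.val_injective)
    simpa only [hZ_law] using h
  have hmeas : Measurable fun ω (i : Fin n) => Z i ω := measurable_pi_lambda _ fun i => hZ_meas i
  rcases lt_or_ge 1 b with hb1 | hb1
  · convert zero_le (a := ENNReal.ofReal δ)
    convert measure_empty (μ := μ)
    refine Set.eq_empty_of_forall_notMem ?_
    rintro ω ⟨k, hk, hkb, -⟩
    have : (2 : ℝ) ≤ k := by exact_mod_cast hk
    nlinarith
  have hsub : {ω | ∃ k : ℕ, 2 ≤ k ∧ k * b ≤ 1 ∧ ¬ BoxUnionDeviation P (fun i : Fin n => Z i ω) k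
        (b * confWidth n b (p + q) (δ * b) k / 6)}
      ⊆ ⋃ k ∈ Finset.Icc 1 ⌊1 / b⌋₊, (fun ω (i : Fin n) => Z i ω) ⁻¹' {z |
        ¬ BoxUnionDeviation P z k (b * confWidth n b (p + q) (δ * b) k / 6)} := by
    rintro ω ⟨k, hk, hkb, h⟩
    simp only [Set.mem_iUnion]
    refine ⟨k, Finset.mem_Icc.mpr ⟨by omega, Nat.le_floor ?_⟩, h⟩
    rwa [le_div_iff₀ hb]
  refine (measure_mono hsub).trans ((measure_biUnion_finset_le _ _).trans ?_)
  -- There are at most `1 / b` values of `k`, each failing with probability at most `δ * b`; hence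
  -- the penalty is a width at level `δ * b`.
  refine (Finset.sum_le_sum (g := fun _ => ENNReal.ofReal (δ * b)) fun k hk => ?_).trans ?_
  · rw [← Measure.map_apply hmeas (measurableSet_not_boxUnionDeviation P k _), hlaw]
    exact measure_not_boxUnionDeviation_le P hn (Finset.mem_Icc.mp hk).1 hb hb1 hδ hδ1
  · rw [Finset.sum_const, Nat.card_Icc, Nat.add_sub_cancel, nsmul_eq_mul,
      ← ENNReal.ofReal_natCast, ← ENNReal.ofReal_mul (Nat.cast_nonneg _)]
    refine ENNReal.ofReal_le_ofReal ?_
    have := Nat.floor_le (a := 1 / b) (by positivity)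
    calc (⌊1 / b⌋₊ : ℝ) * (δ * b) ≤ 1 / b * (δ * b) := by gcongr
      _ = δ := by field_simp

end BoxUnions

/-! ### Optimality of the penalized tree and the regret -/

section Regret

variable {p q n : ℕ}

/-- A split needs a sample point on each side. For `n < 2` the only pruning is therefore the root,
and no deviation bound is required. -/
theorem two_le_of_prunes_fullTree {c : CoordRule p q n} {z : Fin n → Obs p q} {b : ℝ}
    {T : BinTree} (hT : T.Prunes (fullTree c z b)) (hT' : T ≠ BinTree.leaf) : 2 ≤ n := by
  rw [fullTree, growTree] at hT
  split_ifs at hT with hs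
  · have h1 := card_leftCell_lt hs
    have h2 := Finset.card_pos.mpr hs.1.1
    have h3 := Finset.card_le_univ (pointsIn z (Cell.root p q).toSet)
    rw [Fintype.card_fin] at h3
    omega
  · cases T with
    | leaf => exact absurd rfl hT'
    | node l r => exact hT.elim

theorem treePartition_leaf (c : CoordRule p q n) (z : Fin n → Obs p q) :
    treePartition c z BinTree.leaf = [Cell.root p q] := rfl

theorem empDiv_root (hn : n ≠ 0) (z : Fin n → Obs p q) : empDiv z [Cell.root p q] = 0 := by
  simp [empDiv, partitionDiv, empP, empQ, Cell.root, Cell.toSet, empProb_univ hn]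

theorem trueDiv_root (P : Measure (Obs p q)) [IsProbabilityMeasure P] :
    trueDiv P [Cell.root p q] = 0 := by
  have : IsProbabilityMeasure (P.map Prod.fst) := Measure.isProbabilityMeasure_map (by fun_prop)
  have : IsProbabilityMeasure (P.map Prod.snd) := Measure.isProbabilityMeasure_map (by fun_prop)
  simp [trueDiv, partitionDiv, prodMarginals, Cell.root, Cell.toSet]

theorem confWidth_pos (hn : 0 < n) {b δ : ℝ} (hb : 0 < b) (hδ : 0 < δ) (hδ8 : δ ≤ 8) (d : ℕ)
    {k : ℕ} (hk : 0 < k) : 0 < confWidth n b d δ k := by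
  have hn' : (1 : ℝ) ≤ n := by exact_mod_cast hn
  have hk' : (0 : ℝ) < k := by exact_mod_cast hk
  have h1 : 0 ≤ Real.log (8 / δ) := Real.log_nonneg ((one_le_div hδ).mpr hδ8)
  have h2 : 0 ≤ Real.log n := Real.log_nonneg hn'
  have h3 : 0 < Real.log 2 := Real.log_pos (by norm_num)
  unfold confWidth
  positivity

theorem penalty_of_ne_leaf (n : ℕ) (b : ℝ) (d : ℕ) (δ : ℝ) {T : BinTree}
    (hT : T ≠ BinTree.leaf) : penalty n b d δ T.size = confWidth n b d (δ * b) T.size :=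
  if_neg (by have := BinTree.two_le_size hT; omega)

theorem penalty_nonneg (n : ℕ) (b : ℝ) (hb : 0 ≤ b) (d : ℕ) (δ : ℝ) (k : ℕ) :
    0 ≤ penalty n b d δ k := by
  unfold penalty confWidth
  split_ifs <;> positivity

/-- All unions of boxes that the prunings of the full tree can produce have empirical
probabilities close to the true ones. -/
def SmallDeviations (P : Measure (Obs p q)) (z : Fin n → Obs p q) (b δ : ℝ) : Prop :=
  ∀ k : ℕ, 2 ≤ k → k * b ≤ 1 →
    BoxUnionDeviation P z k (b * confWidth n b (p + q) (δ * b) k / 6)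

theorem SmallDeviations.divergence {P : Measure (Obs p q)} [IsProbabilityMeasure P]
    {c : CoordRule p q n} {z : Fin n → Obs p q} {b δ : ℝ}
    (h : 2 ≤ n → SmallDeviations P z b δ) (hb : 0 < b) (hδ : 0 < δ) (hδ1 : δ ≤ 1) {T : BinTree}
    (hT : T.Prunes (fullTree c z b)) (hT' : T ≠ BinTree.leaf) :
    trueDiv P (treePartition c z T) - empDiv z (treePartition c z T)
        ≤ penalty n b (p + q) δ T.size ∧
      (P = prodMarginals P →
        empDiv z (treePartition c z T) < penalty n b (p + q) δ T.size) := by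
  have hn := two_le_of_prunes_fullTree hT hT'
  have hk := size_mul_le_one (by omega) hT hT'
  have hk1 : (1 : ℝ) ≤ T.size := by exact_mod_cast T.size_pos
  have hδb : δ * b ≤ 8 := by nlinarith
  have hpos := confWidth_pos (n := n) (by omega) hb (mul_pos hδ hb) hδb (p + q) T.size_pos
  rw [penalty_of_ne_leaf _ _ _ _ hT']
  have hdev := divergence_deviation (by omega) hb (by positivity) hT hT' P
    (h hn T.size (BinTree.two_le_size hT') hk)
  -- With `t = b * w / 6` the constants `5` and `4` become `5 / 6` and `4 / 6` of the penalty; the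
  -- slack gives the strict inequality under independence.
  have e : ∀ w : ℝ, ∀ m : ℝ, m * (b * w / 6) / b = m / 6 * w := fun w m => by
    field_simp
  rw [e, e] at hdev
  exact ⟨hdev.1.trans (by linarith), fun hP => (hdev.2 hP).trans_lt (by linarith)⟩

theorem zeroRegret_of_smallDeviations {P : Measure (Obs p q)} [IsProbabilityMeasure P]
    (hP : P = prodMarginals P) {c : CoordRule p q n} {z : Fin n → Obs p q} {b δ : ℝ}
    (hn : n ≠ 0) (h : 2 ≤ n → SmallDeviations P z b δ) (hb : 0 < b) (hδ : 0 < δ) (hδ1 : δ ≤ 1)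
    (hz : oracleInfo P z = 0) : ZeroRegret P c z b δ := by
  intro T hT
  obtain rfl : T = BinTree.leaf := by
    by_contra hT'
    have h1 := (SmallDeviations.divergence h hb hδ hδ1 hT.1 hT').2 hP
    -- The root has zero divergence and zero penalty, hence objective zero, which beats the negative
    -- objective of any other tree.
    have h2 := hT.2 BinTree.leaf trivial
    rw [objective, objective, treePartition_leaf, empDiv_root hn] at h2
    simp only [BinTree.size, penalty, if_true] at h1 h2
    linarith
  exact ⟨rfl, by rw [empInfo_treePartition, treePartition_leaf, empDiv_root hn, hz], hz⟩

theorem regretBound_of_smallDeviations {P : Measure (Obs p q)} [IsProbabilityMeasure P]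
    {c : CoordRule p q n} {z : Fin n → Obs p q} {b δ : ℝ}
    (hn : n ≠ 0) (h : 2 ≤ n → SmallDeviations P z b δ) (hb : 0 < b) (hδ : 0 < δ)
    (hδ1 : δ ≤ 1) : RegretBound P c z b δ := by
  intro T hT
  rw [empInfo_treePartition]
  suffices H : (mutualInfo P).toReal - empDiv z (treePartition c z T)
      ≤ oracleTradeoff P c z b δ by linarith
  refine Finset.le_inf' _ _ fun T' hT' => ?_
  rw [BinTree.mem_prunings] at hT'
  have h1 := hT.2 T' hT'
  rw [objective, objective] at h1
  have h2 := penalty_nonneg n b hb.le (p + q) δ T.size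
  -- The deviation bound is used for the competitor only. The selected tree enters through `h1` and
  -- the sign of its penalty.
  have h3 : trueDiv P (treePartition c z T') - empDiv z (treePartition c z T')
      ≤ penalty n b (p + q) δ T'.size := by
    by_cases hl : T' = BinTree.leaf
    · rw [hl, treePartition_leaf, empDiv_root hn, trueDiv_root, sub_zero]
      exact penalty_nonneg n b hb.le (p + q) δ _
    · exact (SmallDeviations.divergence h hb hδ hδ1 hT' hl).1
  linarith

theorem eq_prodMarginals_of_indepFun {P : Measure (Obs p q)} [IsProbabilityMeasure P]
    (h : IndepFun Prod.fst Prod.snd P) : P = prodMarginals P := by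
  have := (indepFun_iff_map_prod_eq_prod_map_map measurable_fst.aemeasurable
    measurable_snd.aemeasurable).mp h
  simpa [prodMarginals] using this

/-- The density of `P` with respect to itself equals one only almost everywhere, which is why a null
event is excluded in addition to the large deviations. -/
theorem ae_oracleInfo_eq_zero {P : Measure (Obs p q)} [IsProbabilityMeasure P]
    (hP : P = prodMarginals P) {Ω : Type*} [MeasurableSpace Ω] {μ : Measure Ω}
    {Z : ℕ → Ω → Obs p q} (hZ_meas : ∀ i, Measurable (Z i)) (hZ_law : ∀ i, μ.map (Z i) = P)
    (n : ℕ) : ∀ᵐ ω ∂μ, oracleInfo P (fun i : Fin n => Z i ω) = 0 := by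
  have h1 : ∀ i, ∀ᵐ ω ∂μ, P.rnDeriv (prodMarginals P) (Z i ω) = 1 := by
    intro i
    have h : ∀ᵐ w ∂(μ.map (Z i)), P.rnDeriv (prodMarginals P) w = 1 := by
      rw [hZ_law i, ← hP]
      exact Measure.rnDeriv_self P
    exact ae_of_ae_map (hZ_meas i).aemeasurable h
  filter_upwards [ae_all_iff.mpr h1] with ω hω
  simp [oracleInfo, hω]

theorem measure_not_smallDeviations_le (P : Measure (Obs p q)) [IsProbabilityMeasure P]
    {Ω : Type*} [MeasurableSpace Ω] (μ : Measure Ω) [IsProbabilityMeasure μ]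
    (Z : ℕ → Ω → Obs p q) (hZ_meas : ∀ i, Measurable (Z i)) (hZ_law : ∀ i, μ.map (Z i) = P)
    (hZ_indep : iIndepFun Z μ) (n : ℕ) {b δ : ℝ} (hb : 0 < b) (hδ : 0 < δ) (hδ1 : δ ≤ 1) :
    μ {ω | ¬ (2 ≤ n → SmallDeviations P (fun i : Fin n => Z i ω) b δ)} ≤ ENNReal.ofReal δ := by
  by_cases hn : 2 ≤ n
  · refine le_trans (measure_mono fun ω hω => ?_) (measure_exists_not_boxUnionDeviation_le
      (n := n) P μ Z hZ_meas hZ_law hZ_indep hn hb hδ hδ1)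
    simpa [SmallDeviations, hn] using hω
  · simp [hn]

/-- An event that fails only if a null event or a large deviation occurs has failure probability
at most `δ`. -/
theorem measure_not_le_of_smallDeviations (P : Measure (Obs p q)) [IsProbabilityMeasure P]
    {Ω : Type*} [MeasurableSpace Ω] (μ : Measure Ω) [IsProbabilityMeasure μ]
    (Z : ℕ → Ω → Obs p q) (hZ_meas : ∀ i, Measurable (Z i)) (hZ_law : ∀ i, μ.map (Z i) = P)
    (hZ_indep : iIndepFun Z μ) (n : ℕ) {b δ : ℝ} (hb : 0 < b) (hδ : 0 < δ) {R : Ω → Prop}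
    (hR : δ ≤ 1 → ∀ᵐ ω ∂μ,
      (2 ≤ n → SmallDeviations P (fun i : Fin n => Z i ω) b δ) → R ω) :
    μ {ω | ¬ R ω} ≤ ENNReal.ofReal δ := by
  rcases le_or_gt δ 1 with hδ1 | hδ1
  · refine (measure_mono_ae ?_).trans
      (measure_not_smallDeviations_le P μ Z hZ_meas hZ_law hZ_indep n hb hδ hδ1)
    filter_upwards [hR hδ1] with ω hω
    exact mt hω
  · exact prob_le_one.trans (ENNReal.one_le_ofReal.mpr hδ1.le)

theorem exists_forall_le_ofReal {δ : ℕ → ℝ} (hδ : δ =o[atTop] fun _ : ℕ => (1 : ℝ))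
    {u : ℕ → ENNReal} (hu : ∀ n, 1 ≤ n → u n ≤ ENNReal.ofReal (δ n)) {ε : ℝ} (hε : 0 < ε) :
    ∃ N : ℕ, ∀ n, N ≤ n → u n ≤ ENNReal.ofReal ε := by
  rw [isLittleO_one_iff] at hδ
  obtain ⟨N, hN⟩ := eventually_atTop.mp ((hδ.eventually (gt_mem_nhds hε)).and
    (eventually_ge_atTop 1))
  exact ⟨N, fun n hn => (hu n (hN n hn).2).trans (ENNReal.ofReal_le_ofReal (hN n hn).1.le)⟩

end Regret

end TSP

/-- The probabilities of failure are bounded (as outer measures), so that no measurability of the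
rule that selects coordinates or of the choice of a solution is needed. -/
theorem theorem2 {p q : ℕ} (hp : 0 < p) (hq : 0 < q)
    (b δ : ℕ → ℝ) (l : ℝ) (hl : l ∈ Set.Ioo (0 : ℝ) (1 / 3))
    (hb_pos : ∀ n, 1 ≤ n → 0 < b n)
    (hb : b =Θ[atTop] fun n : ℕ => (n : ℝ) ^ (-l))
    (hδ_pos : ∀ n, 1 ≤ n → 0 < δ n)
    (hδ : δ =o[atTop] fun _ : ℕ => (1 : ℝ))
    (hδ_inv : (fun n : ℕ => 1 / δ n) =O[atTop] fun n : ℕ => Real.exp ((n : ℝ) ^ (1 / 3 : ℝ)))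
    (c : ∀ n : ℕ, TSP.CoordRule p q n)
    {Ω : Type*} [MeasurableSpace Ω] (μ : Measure Ω) [IsProbabilityMeasure μ]
    (P : Measure (TSP.Obs p q)) [IsProbabilityMeasure P]
    (Z : ℕ → Ω → TSP.Obs p q) (hZ_meas : ∀ i, Measurable (Z i))
    (hZ_law : ∀ i, μ.map (Z i) = P) (hZ_indep : iIndepFun Z μ) :
    (IndepFun Prod.fst Prod.snd P →
      (∀ n, 1 ≤ n →
        μ {ω | ¬ TSP.ZeroRegret P (c n) (fun i : Fin n => Z i ω) (b n) (δ n)}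
          ≤ ENNReal.ofReal (δ n)) ∧
      ∀ ε : ℝ, 0 < ε → ∃ N : ℕ, ∀ n, N ≤ n →
        μ {ω | ¬ TSP.ZeroRegret P (c n) (fun i : Fin n => Z i ω) (b n) (δ n)}
          ≤ ENNReal.ofReal ε) ∧
    (¬ IndepFun Prod.fst Prod.snd P → TSP.mutualInfo P ≠ ⊤ →
      (∀ n, 1 ≤ n →
        μ {ω | ¬ TSP.RegretBound P (c n) (fun i : Fin n => Z i ω) (b n) (δ n)}
          ≤ ENNReal.ofReal (δ n)) ∧
      ∀ ε : ℝ, 0 < ε → ∃ N : ℕ, ∀ n, N ≤ n →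
        μ {ω | ¬ TSP.RegretBound P (c n) (fun i : Fin n => Z i ω) (b n) (δ n)}
          ≤ ENNReal.ofReal ε) := by
  constructor
  · intro hind
    have hP := TSP.eq_prodMarginals_of_indepFun hind
    have key : ∀ n, 1 ≤ n →
        μ {ω | ¬ TSP.ZeroRegret P (c n) (fun i : Fin n => Z i ω) (b n) (δ n)}
          ≤ ENNReal.ofReal (δ n) := fun n hn =>
      TSP.measure_not_le_of_smallDeviations P μ Z hZ_meas hZ_law hZ_indep n (hb_pos n hn)
        (hδ_pos n hn) fun hδ1 => by
          filter_upwards [TSP.ae_oracleInfo_eq_zero hP hZ_meas hZ_law n] with ω hω h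
          exact TSP.zeroRegret_of_smallDeviations hP (by omega) h (hb_pos n hn) (hδ_pos n hn)
            hδ1 hω
    exact ⟨key, fun ε hε => TSP.exists_forall_le_ofReal hδ key hε⟩
  · intro _ _
    have key : ∀ n, 1 ≤ n →
        μ {ω | ¬ TSP.RegretBound P (c n) (fun i : Fin n => Z i ω) (b n) (δ n)}
          ≤ ENNReal.ofReal (δ n) := fun n hn =>
      TSP.measure_not_le_of_smallDeviations P μ Z hZ_meas hZ_law hZ_indep n (hb_pos n hn)
        (hδ_pos n hn) fun hδ1 => ae_of_all _ fun ω h =>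
          TSP.regretBound_of_smallDeviations (by omega) h (hb_pos n hn) (hδ_pos n hn) hδ1
    exact ⟨key, fun ε hε => TSP.exists_forall_le_ofReal hδ key hε⟩
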